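/- Consider the damped transverse electric Maxwell system $$-k^2\mathbf E+\nabla\times(\nabla\times\mathbf E)+ik\sigma\mathbf E=\mathbf 0,\qquad \mathbf E=(E_x,E_y),$$ in a wave-guide of height $\hat L>0$, with perfect electric conductor conditions $E_x=0$ at $y\in\{0,\hat L\}$, where $k,\sigma>0$. Decompose the guide into $N$ overlapping subdomains $\Omega_j=(a_j,b_j)\times(0,\hat L)$, $1\le j\le N$, with $a_{j+1}-a_j=L>0$ and $b_j-a_j=L+2\delta$, $\delta>0$. Let $\mathcal B_l\mathbf E=(-\partial_x+ik)E_y+\partial_yE_x$ and $\mathcal B_r\mathbf E=(\partial_x+ik)E_y-\partial_yE_x$ be the impedance operators. The local errors $\mathbf e_j^n$ of the parallel Schwarz method solve the homogeneous equation in $\Omega_j$ with the conductor conditions at $y\in\{0,\hat L\}$, with $$\mathcal B_l\mathbf e_j^n=\mathcal B_l\mathbf e_{j-1}^{n-1}\ (x=a_j,\ j\ge2),\qquad \mathcal B_r\mathbf e_j^n=\mathcal B_r\mathbf e_{j+1}^{n-1}\ (x=b_j,\ j\le N-1),$$ and with $\mathcal B_l\mathbf e_1^n=0$ at $x=a_1$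 and $\mathcal B_r\mathbf e_N^n=0$ at $x=b_N$. For a Fourier number $\tilde k=m\pi/\hat L$, $m=1,2,\dots$, restrict the method to errors of the form $\mathbf e_j^n=(v_j^n(x)\sin(\tilde ky),\,w_j^n(x)\cos(\tilde ky))$ with $v_j^n,w_j^n$ twice continuously differentiable, and let $\mathcal T_N(\tilde k)\in\mathbb C^{2(N-1)\times2(N-1)}$ be the matrix that maps the amplitudes of the interface data $\mathcal B_r\mathbf e_{j+1}^{n-1}(b_j,\cdot)$, $\mathcal B_l\mathbf e_{j}^{n-1}(a_{j+1},\cdot)$, $1\le j\le N-1$, to those at step $n$. Let $\rho$ be the spectral radius and $$R^{\mathrm M}_{1d}(\tilde k)=\lim_{N\to\infty}\rho(\mathcal T_N(\tilde k)),\qquad R^{\mathrm M}_{2d}=\sup_{\tilde k}R^{\mathrm M}_{1d}(\tilde k).$$ Theorem. For all $k,\sigma,\delta,L,\hat L>0$ the matrices $\mathcal T_N(\tilde k)$ are well defined (they exist and are unique), the limits $R^{\mathrm M}_{1d}(\tilde k)$ exist, and: 1. $R^{\mathrm M}_{1d}(\tilde k)<1$ for every evanescent mode $\tilde k>k$. 2.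 $R^{\mathrm M}_{2d}<1$ if between them $\sigma,\delta,L$ are sufficiently large, in the following sense: for all $k,\varepsilon>0$ there is a constant $C$, depending only on $k$ and $\varepsilon$, such that $R^{\mathrm M}_{2d}<1$ whenever $\sigma,\delta,L\ge\varepsilon$ and $\max\{\sigma,\delta,L\}\ge C$. 3. In particular, $R^{\mathrm M}_{2d}<1$ whenever $\sigma\ge k$, for all $\delta,L>0$. 4. The convergence is ultimately independent of the number of subdomains: $\sup_{\tilde k}\rho(\mathcal T_N(\tilde k))\to R^{\mathrm M}_{2d}$ as $N\to\infty$. -/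

import Mathlib

open scoped ENNReal Topology

/-- Parameters of the two-dimensional transverse electric wave-guide and of its decomposition into
overlapping strips: wave number `k`, damping (conductivity) `σ`, half-overlap `δ`, shift `L` between
consecutive subdomains, height `H` of the guide, abscissa `x₀` of its left end. -/
structure WaveGuide where
  k : ℝ
  σ : ℝ
  δ : ℝ
  L : ℝ
  H : ℝ
  x₀ : ℝ

/-- A transverse electric field `(Ex, Ey)` depending on `(x, y)`. -/
structure TEField where
  Ex : ℝ → ℝ → ℂ
  Ey : ℝ → ℝ → ℂ

namespace WaveGuide

/-- The standing positivity assumptions on the parameters. -/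
def Valid (P : WaveGuide) : Prop :=
  0 < P.k ∧ 0 < P.σ ∧ 0 < P.δ ∧ 0 < P.L ∧ 0 < P.H

/-- Left end of the `j`-th subdomain, `j = 0, 1, 2, …`. -/
def left (P : WaveGuide) (j : ℕ) : ℝ := P.x₀ + j * P.L

/-- Right end of the `j`-th subdomain; subdomains have length `L + 2 δ` and overlap by `2 δ`. -/
def right (P : WaveGuide) (j : ℕ) : ℝ := P.left j + (P.L + 2 * P.δ)

/-- The Fourier number `m π / H`. -/
noncomputable def freq (P : WaveGuide) (m : ℕ+) : ℝ := (m : ℕ) * Real.pi / P.H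

end WaveGuide

/-- Partial derivative in `x`. -/
noncomputable def pdx (f : ℝ → ℝ → ℂ) (x y : ℝ) : ℂ := deriv (fun s => f s y) x

/-- Partial derivative in `y`. -/
noncomputable def pdy (f : ℝ → ℝ → ℂ) (x y : ℝ) : ℂ := deriv (fun t => f x t) y

namespace TEField

/-- The scalar curl `∂ₓ E_y - ∂_y Eₓ`. -/
noncomputable def curl (E : TEField) (x y : ℝ) : ℂ := pdx E.Ey x y - pdy E.Ex x y

/-- The damped Maxwell equation `-k² E + ∇ × (∇ × E) + i k σ E = 0` at `(x, y)`; for a scalar `c`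
one has `∇ × c = (∂_y c, -∂ₓ c)`. -/
def MaxwellAt (P : WaveGuide) (E : TEField) (x y : ℝ) : Prop :=
  -(P.k : ℂ) ^ 2 * E.Ex x y + pdy E.curl x y + Complex.I * P.k * P.σ * E.Ex x y = 0 ∧
  -(P.k : ℂ) ^ 2 * E.Ey x y - pdx E.curl x y + Complex.I * P.k * P.σ * E.Ey x y = 0

/-- Left impedance trace `(-∂ₓ + i k) E_y + ∂_y Eₓ`. -/
noncomputable def traceL (P : WaveGuide) (E : TEField) (x y : ℝ) : ℂ :=
  -pdx E.Ey x y + Complex.I * P.k * E.Ey x y + pdy E.Ex x y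

/-- Right impedance trace `(∂ₓ + i k) E_y - ∂_y Eₓ`. -/
noncomputable def traceR (P : WaveGuide) (E : TEField) (x y : ℝ) : ℂ :=
  pdx E.Ey x y + Complex.I * P.k * E.Ey x y - pdy E.Ex x y

/-- `E` is a (twice continuously differentiable) field in the `m`-th Fourier mode:
`Eₓ = v(x) sin(κ y)`, `E_y = w(x) cos(κ y)` with `κ = m π / H`. -/
def IsMode (P : WaveGuide) (m : ℕ+) (E : TEField) : Prop :=
  ∃ v w : ℝ → ℂ, ContDiff ℝ 2 v ∧ ContDiff ℝ 2 w ∧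
    (∀ x y, E.Ex x y = v x * (Real.sin (P.freq m * y) : ℂ)) ∧
    (∀ x y, E.Ey x y = w x * (Real.cos (P.freq m * y) : ℂ))

end TEField

namespace WaveGuide

/-- One step `e ↦ e'` of the parallel Schwarz method with `M + 1` subdomains, for the local errors
in the `m`-th Fourier mode: each new local error solves the homogeneous damped Maxwell equation in
its subdomain with perfect electric conductor conditions on top and bottom, it receives its impedance
data at the interfaces from the old errors of the neighbours, and it has zero impedance data at the
two ends of the guide. -/
structure ErrorStep (P : WaveGuide) (m : ℕ+) (M : ℕ) (e e' : Fin (M + 1) → TEField) : Prop where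
  mode_old : ∀ j, (e j).IsMode P m
  mode_new : ∀ j, (e' j).IsMode P m
  maxwell : ∀ j : Fin (M + 1), ∀ x ∈ Set.Ioo (P.left j) (P.right j), ∀ y ∈ Set.Ioo 0 P.H,
    (e' j).MaxwellAt P x y
  pec : ∀ j : Fin (M + 1), ∀ x ∈ Set.Ioo (P.left j) (P.right j), (e' j).Ex x 0 = 0 ∧ (e' j).Ex x P.H = 0
  transmit_left : ∀ i : Fin M, ∀ y ∈ Set.Ioo 0 P.H,
    (e' i.succ).traceL P (P.left i.succ) y = (e i.castSucc).traceL P (P.left i.succ) y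
  transmit_right : ∀ i : Fin M, ∀ y ∈ Set.Ioo 0 P.H,
    (e' i.castSucc).traceR P (P.right i.castSucc) y = (e i.succ).traceR P (P.right i.castSucc) y
  left_end : ∀ y ∈ Set.Ioo 0 P.H, (e' 0).traceL P (P.left 0) y = 0
  right_end : ∀ y ∈ Set.Ioo 0 P.H, (e' (Fin.last M)).traceR P (P.right M) y = 0

/-- Interface data of a family of local errors in one Fourier mode. The `i`-th pair belongs to the
overlap of the subdomains `i` and `i + 1`: the right trace of the error `i + 1` at the right end of
the subdomain `i`, and the left trace of the error `i` at the left end of the subdomain `i + 1`.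
In the mode with Fourier number `κ` such a trace is a multiple of `cos (κ y)`, so that its amplitude
is its value at `y = 0`. -/
noncomputable def interfaceData (P : WaveGuide) (M : ℕ) (e : Fin (M + 1) → TEField) :
    Fin M × Fin 2 → ℂ := fun p =>
  if p.2 = 0 then (e p.1.succ).traceR P (P.right p.1.castSucc) 0
  else (e p.1.castSucc).traceL P (P.left p.1.succ) 0

/-- `T` propagates the interface data of the `m`-th Fourier mode in each step of the method. -/
def IsIterationMatrix (P : WaveGuide) (m : ℕ+) (M : ℕ)
    (T : Matrix (Fin M × Fin 2) (Fin M × Fin 2) ℂ) : Prop :=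
  ∀ e e' : Fin (M + 1) → TEField, P.ErrorStep m M e e' →
    P.interfaceData M e' = T.mulVec (P.interfaceData M e)

/-- The iteration matrix of the `m`-th Fourier mode for `M + 1` subdomains. -/
noncomputable def iterationMatrix (P : WaveGuide) (m : ℕ+) (M : ℕ) :
    Matrix (Fin M × Fin 2) (Fin M × Fin 2) ℂ :=
  Classical.epsilon (P.IsIterationMatrix m M)

/-- Spectral radius of the iteration matrix of the `m`-th Fourier mode for `M + 1` subdomains. -/
noncomputable def rho (P : WaveGuide) (m : ℕ+) (M : ℕ) : ℝ≥0∞ :=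
  spectralRadius ℂ (P.iterationMatrix m M)

/-- Convergence factor of the `m`-th Fourier mode as the number of subdomains tends to infinity. -/
noncomputable def R1d (P : WaveGuide) (m : ℕ+) : ℝ≥0∞ :=
  Filter.limUnder Filter.atTop (fun M : ℕ => P.rho m M)

/-- Convergence factor of the two-dimensional method: the supremum over all Fourier modes. -/
noncomputable def R2d (P : WaveGuide) : ℝ≥0∞ := ⨆ m : ℕ+, P.R1d m

end WaveGuide

/-! In one Fourier mode the Maxwell equation becomes the system `v' = κ w`, `κ w' = λ² v` with `λ² =
κ² - k² + i k σ`, so `λ v ± κ w` are pure exponentials. A subdomain therefore acts on its two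
incoming impedance data as the symmetric matrix `[[a, b], [b, a]]` (`scattering`). With `u = exp (-λ
L)`, `g = r exp (-2 λ δ)` and `r` the reflection coefficient of the impedance condition, its
eigenvalues are `a ± b = (u ∓ g) / (1 ∓ g u)`. As every vector of interface data occurs, the
iteration matrix exists, is unique, and is `schwarzMatrix a b M`.

The limit of its spectral radius is `max |a + b| |a - b|`. The upper bound holds for every `M`: the
local matrix is normal, and routing data between neighbours does not increase the ℓ² norm. For the
lower bound, nonzero eigenvalues come from square roots of the zeros of polynomials `p_M` given by a
three-term recurrence, which has a double characteristic root at `μ² = (a ± b)²`. Up to a common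
power, `p_M (μ²)` grows linearly in `M` and `p_M' (μ²)` cubically. Since `p' / p` is the sum of the
`1 / (μ² - z)` over the `M` zeros `z`, some zero tends to `μ²`. The upper bound being uniform in
`M`, limit and supremum over the modes commute.

It remains to show `|u ∓ g| < |1 ∓ g u|`, which follows from `4 |Im u| |Im g| < (1 - |u|²) (1 -
|g|²)`. For `λ = x + i y` this is the product of `2 x |Im u| < y (1 - |u|²)` and `2 y |Im g| ≤ x (1
- |g|²)`; the second holds if `k² - κ² ≤ σ²`, that is, for evanescent modes and for all modes if `σ
≥ k`. If `σ < k`, then `x` is bounded below uniformly in the mode, and a large `δ` or `L` makes `g`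
or `u` small enough. High modes have factors at most `1 / 2`, so the supremum over the modes stays
below one. -/

/-! ### A block Toeplitz matrix and its spectral radius -/

/-- The left data `g (i, 1)` indexed by the subdomain that receives them; zero at the first one. -/
def leftData {M : ℕ} (g : Fin M × Fin 2 → ℂ) : Fin (M + 1) → ℂ :=
  Fin.cons (α := fun _ => ℂ) 0 fun i => g (i, 1)

/-- The right data `g (i, 0)` indexed by the subdomain that receives them; zero at the last one. -/
def rightData {M : ℕ} (g : Fin M × Fin 2 → ℂ) : Fin (M + 1) → ℂ :=
  Fin.snoc (α := fun _ => ℂ) (fun i => g (i, 0)) 0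

section data

variable {M : ℕ} (g h : Fin M × Fin 2 → ℂ) (c : ℂ)

@[simp] lemma leftData_zero : leftData g 0 = 0 := rfl

@[simp] lemma leftData_succ (i : Fin M) : leftData g i.succ = g (i, 1) := rfl

@[simp] lemma rightData_last : rightData g (Fin.last M) = 0 := by simp [rightData]

@[simp] lemma rightData_castSucc (i : Fin M) : rightData g i.castSucc = g (i, 0) := by
  simp [rightData]

lemma leftData_add (j : Fin (M + 1)) : leftData (g + h) j = leftData g j + leftData h j := by
  cases j using Fin.cases <;> simp

lemma leftData_smul (j : Fin (M + 1)) : leftData (c • g) j = c * leftData g j := by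
  cases j using Fin.cases <;> simp

lemma rightData_add (j : Fin (M + 1)) : rightData (g + h) j = rightData g j + rightData h j := by
  cases j using Fin.lastCases <;> simp

lemma rightData_smul (j : Fin (M + 1)) : rightData (c • g) j = c * rightData g j := by
  cases j using Fin.lastCases <;> simp

end data

/-- The matrix that maps the interface data `g` to the data which arise if each subdomain sends the
multiple `a` of its left (right) data to its right (left) neighbour, and reflects the multiple `b`. -/
noncomputable def schwarzMatrix (a b : ℂ) (M : ℕ) : Matrix (Fin M × Fin 2) (Fin M × Fin 2) ℂ :=
  LinearMap.toMatrix'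
    { toFun := fun g p =>
        if p.2 = 0 then a * rightData g p.1.succ + b * leftData g p.1.succ
        else a * leftData g p.1.castSucc + b * rightData g p.1.castSucc
      map_add' := fun g h => by
        ext p
        simp only [leftData_add, rightData_add, Pi.add_apply]
        split_ifs <;> ring
      map_smul' := fun c g => by
        ext p
        simp only [leftData_smul, rightData_smul, Pi.smul_apply, smul_eq_mul, RingHom.id_apply]
        split_ifs <;> ring }

lemma schwarzMatrix_mulVec (a b : ℂ) {M : ℕ} (g : Fin M × Fin 2 → ℂ) (p : Fin M × Fin 2) :
    (schwarzMatrix a b M).mulVec g p =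
      if p.2 = 0 then a * rightData g p.1.succ + b * leftData g p.1.succ
      else a * leftData g p.1.castSucc + b * rightData g p.1.castSucc := by
  rw [schwarzMatrix, LinearMap.toMatrix'_mulVec]
  rfl

lemma Matrix.mem_spectrum_iff_exists_mulVec {n : Type*} [Fintype n] [DecidableEq n]
    (T : Matrix n n ℂ) (x : ℂ) : x ∈ spectrum ℂ T ↔ ∃ g ≠ 0, T.mulVec g = x • g := by
  rw [← Matrix.spectrum_toLin', ← Module.End.hasEigenvalue_iff_mem_spectrum]
  constructor
  · intro h
    obtain ⟨g, hg⟩ := h.exists_hasEigenvector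
    exact ⟨g, hg.2, by simpa using hg.apply_eq_smul⟩
  · rintro ⟨g, hg, h⟩
    exact Module.End.hasEigenvalue_of_hasEigenvector
      ⟨Module.End.mem_eigenspace_iff.2 (by simpa using h), hg⟩

/-- The symmetric matrix is diagonal in the orthogonal coordinates `p ± q`, with eigenvalues `a ±
b`; the parallelogram law changes coordinates. -/
lemma norm_sq_add_norm_sq_le (a b p q : ℂ) :
    ‖a * p + b * q‖ ^ 2 + ‖b * p + a * q‖ ^ 2 ≤
      max ‖a + b‖ ‖a - b‖ ^ 2 * (‖p‖ ^ 2 + ‖q‖ ^ 2) := by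
  have h1 := parallelogram_law_with_norm ℝ (a * p + b * q) (b * p + a * q)
  have h2 := parallelogram_law_with_norm ℝ p q
  have e1 : a * p + b * q + (b * p + a * q) = (a + b) * (p + q) := by ring
  have e2 : a * p + b * q - (b * p + a * q) = (a - b) * (p - q) := by ring
  rw [e1, e2, norm_mul, norm_mul] at h1
  have h3 : ‖a + b‖ ^ 2 ≤ max ‖a + b‖ ‖a - b‖ ^ 2 := by gcongr; exact le_max_left _ _
  have h4 : ‖a - b‖ ^ 2 ≤ max ‖a + b‖ ‖a - b‖ ^ 2 := by gcongr; exact le_max_right _ _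
  nlinarith [mul_le_mul_of_nonneg_right h3 (sq_nonneg ‖p + q‖),
    mul_le_mul_of_nonneg_right h4 (sq_nonneg ‖p - q‖)]

lemma norm_le_of_mem_spectrum_schwarzMatrix {a b x : ℂ} {M : ℕ}
    (hx : x ∈ spectrum ℂ (schwarzMatrix a b M)) : ‖x‖ ≤ max ‖a + b‖ ‖a - b‖ := by
  obtain ⟨g, hg0, hg⟩ := (Matrix.mem_spectrum_iff_exists_mulVec _ _).1 hx
  set R := max ‖a + b‖ ‖a - b‖ with hR
  have hR0 : 0 ≤ R := (norm_nonneg _).trans (le_max_left _ _)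
  set S := ∑ p, ‖g p‖ ^ 2 with hS
  have hS0 : 0 < S := by
    obtain ⟨p, hp⟩ := Function.ne_iff.1 hg0
    exact Finset.sum_pos' (fun _ _ => by positivity)
      ⟨p, Finset.mem_univ _, by have := norm_pos_iff.2 hp; positivity⟩
  have hsum : S = ∑ j, (‖leftData g j‖ ^ 2 + ‖rightData g j‖ ^ 2) := by
    rw [Finset.sum_add_distrib, Fin.sum_univ_succ, Fin.sum_univ_castSucc (fun j => ‖rightData g j‖ ^ 2),
      hS, Fintype.sum_prod_type]
    simp [Finset.sum_add_distrib, add_comm]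
  have hT : ‖x‖ ^ 2 * S = ∑ p, ‖(schwarzMatrix a b M).mulVec g p‖ ^ 2 := by
    rw [hg, hS, Finset.mul_sum]
    simp [mul_pow]
  have hle : ‖x‖ ^ 2 * S ≤ R ^ 2 * S := by
    rw [hT, hsum, Finset.mul_sum, Fintype.sum_prod_type]
    simp only [schwarzMatrix_mulVec, Fin.sum_univ_two, if_true, one_ne_zero, if_false]
    rw [Finset.sum_add_distrib]
    -- What the first and last subdomains would send out of the guide is missing on the left; adding
    -- it only enlarges the sum.
    have h1 : ∑ i : Fin M, ‖a * rightData g i.succ + b * leftData g i.succ‖ ^ 2 ≤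
        ∑ j, ‖a * rightData g j + b * leftData g j‖ ^ 2 := by
      rw [Fin.sum_univ_succ (fun j => ‖a * rightData g j + b * leftData g j‖ ^ 2)]
      exact le_add_of_nonneg_left (by positivity)
    have h2 : ∑ i : Fin M, ‖a * leftData g i.castSucc + b * rightData g i.castSucc‖ ^ 2 ≤
        ∑ j, ‖a * leftData g j + b * rightData g j‖ ^ 2 := by
      rw [Fin.sum_univ_castSucc (fun j => ‖a * leftData g j + b * rightData g j‖ ^ 2)]
      exact le_add_of_nonneg_right (by positivity)
    refine (add_le_add h1 h2).trans ?_
    rw [← Finset.sum_add_distrib]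
    refine Finset.sum_le_sum fun j _ => ?_
    have := norm_sq_add_norm_sq_le a b (leftData g j) (rightData g j)
    rw [add_comm (a * rightData g j), add_comm (‖b * _ + _‖ ^ 2)]
    exact this
  exact abs_le_of_sq_le_sq' (le_of_mul_le_mul_right hle hS0) hR0 |>.2

/-! ### Characteristic polynomials and their growth at the double root -/

open Polynomial in
/-- The characteristic polynomials (in the square of the eigenvalue) of the matrices
`schwarzMatrix a b M`, where `α = a ^ 2` and `β = b ^ 2`, together with auxiliary polynomials. -/
noncomputable def schwarzPoly (α β : ℂ) : ℕ → ℂ[X] × ℂ[X]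
  | 0 => (1, C β)
  | n + 1 =>
    let p := X * (schwarzPoly α β n).1 - (schwarzPoly α β n).2
    (p, C α * (schwarzPoly α β n).2 + C β * p)

section poly

open Polynomial

variable (α β : ℂ)

lemma schwarzPoly_succ_fst (n : ℕ) : (schwarzPoly α β (n + 1)).1 =
    X * (schwarzPoly α β n).1 - (schwarzPoly α β n).2 := rfl

lemma schwarzPoly_succ_snd (n : ℕ) : (schwarzPoly α β (n + 1)).2 =
    C α * (schwarzPoly α β n).2 + C β * (schwarzPoly α β (n + 1)).1 := rfl

lemma schwarzPoly_add_two (n : ℕ) : (schwarzPoly α β (n + 2)).1 =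
    (X + C (α - β)) * (schwarzPoly α β (n + 1)).1 - C α * X * (schwarzPoly α β n).1 := by
  have h : (schwarzPoly α β n).2 = X * (schwarzPoly α β n).1 - (schwarzPoly α β (n + 1)).1 := by
    rw [schwarzPoly_succ_fst]; ring
  rw [schwarzPoly_succ_fst α β (n + 1), schwarzPoly_succ_snd, h, C_sub]
  ring

lemma schwarzPoly_monic (n : ℕ) : (schwarzPoly α β n).1.Monic ∧
    (schwarzPoly α β n).1.degree = n ∧ (schwarzPoly α β n).2.degree ≤ n := by
  induction n with
  | zero => exact ⟨monic_one, degree_one, degree_C_le⟩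
  | succ n ih =>
    obtain ⟨h1, h2, h3⟩ := ih
    have hd : (X * (schwarzPoly α β n).1).degree = ((n + 1 : ℕ) : WithBot ℕ) := by
      rw [degree_mul, degree_X, h2]; push_cast; ring
    have hlt : (schwarzPoly α β n).2.degree < (X * (schwarzPoly α β n).1).degree := by
      rw [hd]; exact h3.trans_lt (by exact_mod_cast n.lt_succ_self)
    have h4 : (schwarzPoly α β (n + 1)).1.degree = ((n + 1 : ℕ) : WithBot ℕ) := by
      rw [schwarzPoly_succ_fst, degree_sub_eq_left_of_degree_lt hlt, hd]
    refine ⟨(monic_X.mul h1).sub_of_left hlt, h4, ?_⟩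
    rw [schwarzPoly_succ_snd]
    refine (degree_add_le _ _).trans (max_le ?_ ?_)
    · exact (C_mul' _ (_ : ℂ[X]) ▸ degree_smul_le _ _).trans (h3.trans (by exact_mod_cast n.le_succ))
    · exact (C_mul' _ (_ : ℂ[X]) ▸ degree_smul_le _ _).trans h4.le

end poly

lemma mem_spectrum_schwarzMatrix {a b x : ℂ} (ha : a ≠ 0) (hb : b ≠ 0) (hx : x ≠ 0) {M : ℕ}
    (hroot : (schwarzPoly (a ^ 2) (b ^ 2) M).1.eval (x ^ 2) = 0) :
    x ∈ spectrum ℂ (schwarzMatrix a b M) := by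
  set p : ℕ → ℂ := fun n => (schwarzPoly (a ^ 2) (b ^ 2) n).1.eval (x ^ 2) with hp
  set w : ℕ → ℂ := fun n => (schwarzPoly (a ^ 2) (b ^ 2) n).2.eval (x ^ 2) with hw
  have hp0 : p 0 = 1 := by simp [hp, schwarzPoly]
  have hw0 : w 0 = b ^ 2 := by simp [hw, schwarzPoly]
  have hps (n : ℕ) : p (n + 1) = x ^ 2 * p n - w n := by
    simp [hp, hw, schwarzPoly_succ_fst]
  have hws (n : ℕ) : w (n + 1) = a ^ 2 * w n + b ^ 2 * p (n + 1) := by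
    simp [hp, hw, schwarzPoly_succ_snd]
  set X : ℕ → ℂ := fun n => p n / (a * x) ^ n with hX
  set Y : ℕ → ℂ := fun n => w n / (b * x * (a * x) ^ n) with hY
  have hX1 (n : ℕ) : a * X (n + 1) + b * Y n = x * X n := by
    simp only [hX, hY, hps]
    field_simp
    ring
  have hY0 : b * X 0 = x * Y 0 := by
    simp only [hX, hY, hp0, hw0]
    field_simp
  have hY1 (n : ℕ) : a * Y n + b * X (n + 1) = x * Y (n + 1) := by
    simp only [hX, hY, hws, pow_succ]
    field_simp
    try ring
  have hXM : X M = 0 := by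
    have : p M = 0 := hroot
    simp [hX, this]
  have hM : 0 < M := by
    rcases Nat.eq_zero_or_pos M with rfl | h
    · simp [schwarzPoly] at hroot
    · exact h
  set g : Fin M × Fin 2 → ℂ := fun q => if q.2 = 0 then X q.1 else Y q.1 with hg
  have hr (j : Fin (M + 1)) : rightData g j = X j := by
    cases j using Fin.lastCases with
    | last => simp [hXM]
    | cast i => simp [hg]
  refine (Matrix.mem_spectrum_iff_exists_mulVec _ _).2 ⟨g, ?_, ?_⟩
  · intro h
    have := congrFun h (⟨0, hM⟩, 0)
    simp [hg, hX, hp0] at this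
  · ext ⟨i, s⟩
    rw [schwarzMatrix_mulVec]
    fin_cases s
    · simp only [hr, leftData_succ]
      simpa [hg] using hX1 i
    · obtain ⟨i, hi⟩ := i
      cases i with
      | zero =>
        have : (⟨0, hi⟩ : Fin M).castSucc = 0 := rfl
        simp only [this, leftData_zero, hr]
        simpa [hg] using hY0
      | succ n =>
        have : (⟨n + 1, hi⟩ : Fin M).castSucc = (⟨n, by omega⟩ : Fin M).succ := rfl
        simp only [hr, this, leftData_succ]
        simpa [hg] using hY1 n

/-- At `μ ^ 2` the three-term recurrence has the double characteristic root `a * μ`, hence a power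
times a factor linear in `n`. -/
lemma schwarzPoly_eval {a b μ : ℂ} (hμ : μ = a + b) (n : ℕ) :
    μ * (schwarzPoly (a ^ 2) (b ^ 2) n).1.eval (μ ^ 2) = (a * μ) ^ n * (μ + n * b) ∧
      (schwarzPoly (a ^ 2) (b ^ 2) n).2.eval (μ ^ 2) = (a * μ) ^ n * (n + 1) * b ^ 2 := by
  induction n with
  | zero => simp [schwarzPoly]
  | succ n ih =>
    obtain ⟨h1, h2⟩ := ih
    have h3 : μ * (schwarzPoly (a ^ 2) (b ^ 2) (n + 1)).1.eval (μ ^ 2) =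
        (a * μ) ^ (n + 1) * (μ + (n + 1 : ℕ) * b) := by
      simp only [schwarzPoly_succ_fst, Polynomial.eval_sub, Polynomial.eval_mul, Polynomial.eval_X]
      rw [mul_sub, mul_left_comm, h1, h2, hμ]
      push_cast
      ring
    refine ⟨h3, ?_⟩
    by_cases hμ0 : μ = 0
    · have hab : b ^ 2 = a ^ 2 := by
        have : b = -a := by rw [hμ0] at hμ; linear_combination -hμ
        rw [this]; ring
      rw [schwarzPoly_succ_snd, schwarzPoly_succ_fst]
      simp [hμ0, hab]
    · have h4 : (schwarzPoly (a ^ 2) (b ^ 2) (n + 1)).1.eval (μ ^ 2) =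
          (a * μ) ^ (n + 1) * (μ + (n + 1 : ℕ) * b) / μ := by
        rw [← h3]; field_simp
      rw [schwarzPoly_succ_snd]
      simp only [Polynomial.eval_add, Polynomial.eval_mul, Polynomial.eval_C, h2, h4]
      field_simp
      rw [hμ]
      push_cast
      ring

/-- The normalised derivatives of the polynomials `schwarzPoly` at the point `(a + b) ^ 2`. -/
noncomputable def schwarzSlope (a b μ : ℂ) (n : ℕ) : ℂ :=
  n / (a * μ) + (1 / (a * μ) - (1 - b / μ) / μ ^ 2) * (n * (n - 1) / 2) +
    b / μ * (1 / (a * μ) - 1 / μ ^ 2) * ((n - 1) * n * (n + 1) / 6)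

/-- Differentiating the recurrence gives the same double root with a resonant right-hand side linear
in `n`; two degrees are gained, and the slope is cubic. -/
lemma schwarzPoly_derivative_eval {a b μ : ℂ} (ha : a ≠ 0) (hμ0 : μ ≠ 0) (hμ : μ = a + b)
    (n : ℕ) : (schwarzPoly (a ^ 2) (b ^ 2) n).1.derivative.eval (μ ^ 2) =
      (a * μ) ^ n * schwarzSlope a b μ n := by
  induction n using Nat.twoStepInduction with
  | zero => simp [schwarzPoly, schwarzSlope]
  | one =>
    have h : (Polynomial.C b ^ 2).derivative = 0 := by rw [← Polynomial.C_pow, Polynomial.derivative_C]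
    simp [schwarzPoly, schwarzSlope, h]
    field_simp
  | more n h1 h2 =>
    have hP (j : ℕ) : (schwarzPoly (a ^ 2) (b ^ 2) j).1.eval (μ ^ 2) =
        (a * μ) ^ j * (μ + j * b) / μ := by
      rw [← (schwarzPoly_eval hμ j).1]; field_simp
    rw [schwarzPoly_add_two]
    simp only [Polynomial.derivative_sub, Polynomial.derivative_mul, Polynomial.derivative_add,
      Polynomial.derivative_X, Polynomial.derivative_C, Polynomial.eval_sub, Polynomial.eval_add,
      Polynomial.eval_mul, Polynomial.eval_X, Polynomial.eval_C, Polynomial.eval_one,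
      Polynomial.eval_zero, h1, h2, hP, schwarzSlope]
    have hb : b = μ - a := by rw [hμ]; ring
    rw [hb]
    simp only [pow_succ]
    push_cast
    field_simp
    ring

lemma tendsto_schwarz_quotient {a b μ : ℂ} (ha : a ≠ 0) (hb : b ≠ 0) (hμ0 : μ ≠ 0)
    (hμ : μ = a + b) :
    Filter.Tendsto (fun n : ℕ => (n : ℂ) * (1 + n * b / μ) / schwarzSlope a b μ n)
      Filter.atTop (𝓝 0) ∧ ∀ᶠ n : ℕ in Filter.atTop, schwarzSlope a b μ n ≠ 0 := by
  set f : ℂ → ℂ := fun h => h * (h + b / μ) with hf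
  set g : ℂ → ℂ := fun h => h ^ 2 / (a * μ) +
    (1 / (a * μ) - (1 - b / μ) / μ ^ 2) * (h * (1 - h) / 2) +
    b / μ * (1 / (a * μ) - 1 / μ ^ 2) * ((1 - h ^ 2) / 6) with hg
  -- With `h = 1 / n`, numerator and slope are `n ^ 3 * f h` and `n ^ 3 * g h`. The leading
  -- coefficient `g 0` equals `b ^ 2 / (6 * a * μ ^ 3)`, whereas `f 0 = 0`.
  have hg0 : g 0 ≠ 0 := by
    have : (1 / (a * μ) - 1 / μ ^ 2) = b / (a * μ ^ 2) := by
      rw [hμ] at hμ0 ⊢; field_simp; ring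
    simp only [hg, this]
    simp [ha, hb, hμ0]
  have hlim : Filter.Tendsto (fun n : ℕ => (n : ℂ)⁻¹) Filter.atTop (𝓝 0) :=
    tendsto_inv_atTop_nhds_zero_nat
  have hgl : Filter.Tendsto (fun n : ℕ => g (n : ℂ)⁻¹) Filter.atTop (𝓝 (g 0)) :=
    (Continuous.tendsto (by fun_prop) 0).comp hlim
  have hfl : Filter.Tendsto (fun n : ℕ => f (n : ℂ)⁻¹) Filter.atTop (𝓝 (f 0)) :=
    (Continuous.tendsto (by fun_prop) 0).comp hlim
  have hslope : ∀ n : ℕ, 0 < n → schwarzSlope a b μ n = (n : ℂ) ^ 3 * g (n : ℂ)⁻¹ := by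
    intro n hn
    have hn : (n : ℂ) ≠ 0 := by exact_mod_cast hn.ne'
    simp only [hg, schwarzSlope]
    field_simp
    ring
  constructor
  · have h := hfl.div hgl hg0
    rw [show f 0 = 0 by simp [hf], zero_div] at h
    refine h.congr' ?_
    filter_upwards [Filter.eventually_gt_atTop 0] with n hn
    rw [Pi.div_apply, hslope n hn]
    have hn : (n : ℂ) ≠ 0 := by exact_mod_cast hn.ne'
    rw [← div_div]
    congr 1
    simp only [hf]
    field_simp
  · filter_upwards [Filter.eventually_gt_atTop 0, hgl.eventually_ne hg0] with n hn hgn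
    rw [hslope n hn]
    exact mul_ne_zero (pow_ne_zero _ (by exact_mod_cast hn.ne')) hgn

/-- The logarithmic derivative at `x` is the sum of `1 / (x - z)` over the roots, each term being at
most `1 / d`. -/
lemma Polynomial.norm_derivative_eval_mul_le {p : Polynomial ℂ} {x : ℂ} {d : ℝ} (hd : 0 < d)
    (h : ∀ z, p.eval z = 0 → d ≤ ‖x - z‖) :
    ‖p.derivative.eval x‖ * d ≤ p.natDegree * ‖p.eval x‖ := by
  by_cases hx : p.eval x = 0
  · have := h x hx
    simp at this
    linarith
  have hp : p ≠ 0 := by rintro rfl; simp at hx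
  rw [(IsAlgClosed.splits p).eval_derivative_eq_eval_mul_sum hx, norm_mul]
  have hsum : ‖(p.roots.map fun z => 1 / (x - z)).sum‖ ≤ p.natDegree * d⁻¹ := by
    refine (Multiset.le_sum_of_subadditive norm norm_zero.le norm_add_le _).trans ?_
    rw [Multiset.map_map]
    refine (Multiset.sum_le_card_nsmul _ d⁻¹ ?_).trans ?_
    · intro y hy
      obtain ⟨z, hz, rfl⟩ := Multiset.mem_map.1 hy
      have := h z ((Polynomial.mem_roots hp).1 hz)
      simp only [Function.comp, one_div, norm_inv]
      gcongr
    · rw [Multiset.card_map, nsmul_eq_mul]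
      gcongr
      exact p.card_roots'
  calc ‖p.eval x‖ * ‖(p.roots.map fun z => 1 / (x - z)).sum‖ * d
      ≤ ‖p.eval x‖ * (p.natDegree * d⁻¹) * d := by gcongr
    _ = p.natDegree * ‖p.eval x‖ := by field_simp

/-! ### Limit of the spectral radius -/

lemma spectralRadius_schwarzMatrix_le (a b : ℂ) (M : ℕ) :
    spectralRadius ℂ (schwarzMatrix a b M) ≤ ENNReal.ofReal (max ‖a + b‖ ‖a - b‖) := by
  refine iSup₂_le fun x hx => ?_
  rw [← enorm_eq_nnnorm, ← ofReal_norm]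
  exact ENNReal.ofReal_le_ofReal (norm_le_of_mem_spectrum_schwarzMatrix hx)

/-- The polynomials depend on `b` only through `b ^ 2`, so `c = b` and `c = -b` treat `a + b` and `a
- b` together. -/
lemma eventually_exists_mem_spectrum_schwarzMatrix {a b c : ℂ} (ha : a ≠ 0) (hb : b ≠ 0)
    (hc : c ^ 2 = b ^ 2) {s : ℝ} (hs : 0 ≤ s) (hsμ : s < ‖a + c‖) :
    ∀ᶠ M : ℕ in Filter.atTop, ∃ x ∈ spectrum ℂ (schwarzMatrix a b M), s < ‖x‖ := by
  set μ := a + c with hμ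
  have hμ0 : μ ≠ 0 := norm_pos_iff.1 (hs.trans_lt hsμ)
  have hc0 : c ≠ 0 := by
    rintro rfl
    exact hb (by simpa using hc.symm)
  -- If no eigenvalue exceeds `s` in modulus, all roots lie in the disc of radius `s ^ 2`, hence at
  -- distance at least `d` from `μ ^ 2`. Then a cubic would be bounded by a quadratic in `M`.
  set d := ‖μ‖ ^ 2 - s ^ 2 with hd
  have hd0 : 0 < d := by rw [hd]; nlinarith
  obtain ⟨hlim, hne⟩ := tendsto_schwarz_quotient ha hc0 hμ0 hμ
  replace hlim := hlim.norm
  rw [norm_zero] at hlim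
  filter_upwards [hlim.eventually_lt_const hd0, hne] with M hM hM0
  by_contra! hcon
  have hroot : ∀ z, (schwarzPoly (a ^ 2) (b ^ 2) M).1.eval z = 0 → d ≤ ‖μ ^ 2 - z‖ := by
    intro z hz
    have hzs : ‖z‖ ≤ s ^ 2 := by
      by_cases hz0 : z = 0
      · rw [hz0, norm_zero]; positivity
      obtain ⟨x, rfl⟩ := IsSquare.exists_sq z (IsAlgClosed.exists_pow_nat_eq z two_pos |>.imp
        fun x hx => by rw [← hx, sq])
      have hx := hcon x (mem_spectrum_schwarzMatrix ha hb (by rintro rfl; simp at hz0) hz)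
      rw [norm_pow]
      gcongr
    have := norm_sub_norm_le (μ ^ 2) z
    rw [norm_pow] at this
    linarith
  have key := Polynomial.norm_derivative_eval_mul_le hd0 hroot
  have hdeg : (schwarzPoly (a ^ 2) (b ^ 2) M).1.natDegree = M :=
    Polynomial.natDegree_eq_of_degree_eq_some (schwarzPoly_monic _ _ M).2.1
  rw [hdeg, ← hc, schwarzPoly_derivative_eval ha hμ0 hμ] at key
  have hP : (schwarzPoly (a ^ 2) (c ^ 2) M).1.eval (μ ^ 2) = (a * μ) ^ M * (1 + M * c / μ) := by
    have := (schwarzPoly_eval hμ M).1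
    field_simp
    linear_combination this
  rw [hP, norm_mul, norm_mul] at key
  have hpos : 0 < ‖(a * μ) ^ M‖ := norm_pos_iff.2 (by positivity)
  have key2 : ‖schwarzSlope a c μ M‖ * d ≤ ‖(M : ℂ) * (1 + M * c / μ)‖ := by
    rw [norm_mul, Complex.norm_natCast]
    refine le_of_mul_le_mul_left ?_ hpos
    linarith
  rw [norm_div, div_lt_iff₀ (norm_pos_iff.2 hM0)] at hM
  linarith

lemma tendsto_spectralRadius_schwarzMatrix {a b : ℂ} (ha : a ≠ 0) (hb : b ≠ 0) :
    Filter.Tendsto (fun M => spectralRadius ℂ (schwarzMatrix a b M)) Filter.atTop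
      (𝓝 (ENNReal.ofReal (max ‖a + b‖ ‖a - b‖))) := by
  refine tendsto_order.2 ⟨fun r hr => ?_, fun r hr => Filter.Eventually.of_forall fun M =>
    (spectralRadius_schwarzMatrix_le a b M).trans_lt hr⟩
  have hr' : r ≠ ∞ := (hr.trans_le le_top).ne
  have hlt : r.toReal < max ‖a + b‖ ‖a - b‖ := (ENNReal.lt_ofReal_iff_toReal_lt hr').1 hr
  have : ∃ c, c ^ 2 = b ^ 2 ∧ r.toReal < ‖a + c‖ := by
    rcases lt_max_iff.1 hlt with h | h
    · exact ⟨b, rfl, h⟩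
    · exact ⟨-b, by ring, by rwa [← sub_eq_add_neg]⟩
  obtain ⟨c, hc, hcr⟩ := this
  filter_upwards [eventually_exists_mem_spectrum_schwarzMatrix ha hb hc ENNReal.toReal_nonneg hcr]
    with M ⟨x, hx, hrx⟩
  refine lt_of_lt_of_le ?_ (le_iSup₂ (f := fun x (_ : x ∈ spectrum ℂ (schwarzMatrix a b M)) =>
    ((‖x‖₊ : NNReal) : ℝ≥0∞)) x hx)
  rw [← enorm_eq_nnnorm, ← ofReal_norm]
  exact (ENNReal.lt_ofReal_iff_toReal_lt hr').2 hrx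

/-! ### Maxwell fields in one Fourier mode -/

lemma Complex.exists_sq_eq_of_im_pos {w : ℂ} (hw : 0 < w.im) :
    ∃ z : ℂ, z ^ 2 = w ∧ 0 < z.re ∧ 0 < z.im := by
  obtain ⟨z, hz⟩ := IsAlgClosed.exists_pow_nat_eq w two_pos
  have him : w.im = 2 * (z.re * z.im) := by rw [← hz, sq, Complex.mul_im]; ring
  have hpos : 0 < z.re * z.im := by linarith
  rcases mul_pos_iff.1 hpos with ⟨h1, h2⟩ | ⟨h1, h2⟩
  · exact ⟨z, hz, h1, h2⟩
  · exact ⟨-z, by rw [neg_sq, hz], by simpa using h1, by simpa using h2⟩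

namespace WaveGuide

/-- The complex coefficient `k² - i k σ` of the damped Maxwell equation. -/
noncomputable def medium (P : WaveGuide) : ℂ := (P.k : ℂ) ^ 2 - Complex.I * P.k * P.σ

lemma freq_pos {P : WaveGuide} (hP : P.Valid) (m : ℕ+) : 0 < P.freq m := by
  have := hP.2.2.2.2
  have := Real.pi_pos
  have := m.pos
  unfold freq
  positivity

lemma exists_decayRate {P : WaveGuide} (hP : P.Valid) (m : ℕ+) : ∃ z : ℂ,
    z ^ 2 = (P.freq m : ℂ) ^ 2 - P.medium ∧ 0 < z.re ∧ 0 < z.im := by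
  apply Complex.exists_sq_eq_of_im_pos
  have := mul_pos hP.1 hP.2.1
  simpa [medium, ← Complex.ofReal_pow]

open Classical in
/-- The square root of `κ² - k² + i k σ` in the first quadrant. -/
noncomputable def decayRate (P : WaveGuide) (m : ℕ+) : ℂ :=
  if h : P.Valid then (exists_decayRate h m).choose else 0

section decayRate

variable {P : WaveGuide} (hP : P.Valid) (m : ℕ+)
include hP

lemma decayRate_sq : P.decayRate m ^ 2 = (P.freq m : ℂ) ^ 2 - P.medium := by
  simpa [decayRate, hP] using (exists_decayRate hP m).choose_spec.1

lemma decayRate_re_pos : 0 < (P.decayRate m).re := by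
  simpa [decayRate, hP] using (exists_decayRate hP m).choose_spec.2.1

lemma decayRate_im_pos : 0 < (P.decayRate m).im := by
  simpa [decayRate, hP] using (exists_decayRate hP m).choose_spec.2.2

lemma decayRate_ne_zero : P.decayRate m ≠ 0 := by
  intro h
  simpa [h] using decayRate_re_pos hP m

lemma medium_ne_zero : P.medium ≠ 0 := by
  intro h
  have := congrArg Complex.im h
  simp [medium, ← Complex.ofReal_pow] at this
  exact this.elim hP.1.ne' hP.2.1.ne'

end decayRate

/-- The field in the `m`-th Fourier mode with given amplitudes. -/
noncomputable def modeField (P : WaveGuide) (m : ℕ+) (v w : ℝ → ℂ) : TEField where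
  Ex x y := v x * (Real.sin (P.freq m * y) : ℂ)
  Ey x y := w x * (Real.cos (P.freq m * y) : ℂ)

end WaveGuide

lemma TEField.isMode_iff {P : WaveGuide} {m : ℕ+} {E : TEField} : E.IsMode P m ↔
    ∃ v w : ℝ → ℂ, ContDiff ℝ 2 v ∧ ContDiff ℝ 2 w ∧ E = P.modeField m v w := by
  constructor
  · rintro ⟨v, w, hv, hw, h1, h2⟩
    refine ⟨v, w, hv, hw, ?_⟩
    cases E
    simp only [WaveGuide.modeField, TEField.mk.injEq]
    exact ⟨funext fun x => funext (h1 x), funext fun x => funext (h2 x)⟩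
  · rintro ⟨v, w, hv, hw, rfl⟩
    exact ⟨v, w, hv, hw, fun _ _ => rfl, fun _ _ => rfl⟩

namespace WaveGuide

variable {P : WaveGuide} {m : ℕ+} {v w : ℝ → ℂ}

lemma hasDerivAt_sin_freq (κ y : ℝ) :
    HasDerivAt (fun t : ℝ => (Real.sin (κ * t) : ℂ)) (κ * (Real.cos (κ * y) : ℂ)) y := by
  refine (((hasDerivAt_id' y).const_mul κ).sin).ofReal_comp.congr_deriv ?_
  push_cast
  ring

lemma hasDerivAt_cos_freq (κ y : ℝ) :
    HasDerivAt (fun t : ℝ => (Real.cos (κ * t) : ℂ)) (-(κ * (Real.sin (κ * y) : ℂ))) y := by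
  refine (((hasDerivAt_id' y).const_mul κ).cos).ofReal_comp.congr_deriv ?_
  push_cast
  ring

lemma pdx_modeField_Ey (x y : ℝ) :
    pdx (P.modeField m v w).Ey x y = deriv w x * (Real.cos (P.freq m * y) : ℂ) :=
  deriv_mul_const_field _

lemma pdy_modeField_Ex (x y : ℝ) : pdy (P.modeField m v w).Ex x y =
    P.freq m * v x * (Real.cos (P.freq m * y) : ℂ) := by
  have := ((hasDerivAt_sin_freq (P.freq m) y).const_mul (v x)).deriv
  rw [pdy]
  refine this.trans ?_
  ring

lemma traceL_modeField (x y : ℝ) : (P.modeField m v w).traceL P x y =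
    (-deriv w x + Complex.I * P.k * w x + P.freq m * v x) * (Real.cos (P.freq m * y) : ℂ) := by
  rw [TEField.traceL, pdx_modeField_Ey, pdy_modeField_Ex]
  simp only [modeField]
  ring

lemma traceR_modeField (x y : ℝ) : (P.modeField m v w).traceR P x y =
    (deriv w x + Complex.I * P.k * w x - P.freq m * v x) * (Real.cos (P.freq m * y) : ℂ) := by
  rw [TEField.traceR, pdx_modeField_Ey, pdy_modeField_Ex]
  simp only [modeField]
  ring

lemma curl_modeField : (P.modeField m v w).curl =
    fun x y => (deriv w x - P.freq m * v x) * (Real.cos (P.freq m * y) : ℂ) := by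
  ext x y
  rw [TEField.curl, pdx_modeField_Ey, pdy_modeField_Ex]
  ring

lemma maxwellAt_modeField_iff (x y : ℝ) : (P.modeField m v w).MaxwellAt P x y ↔
    (P.medium * v x + P.freq m * (deriv w x - P.freq m * v x)) *
        (Real.sin (P.freq m * y) : ℂ) = 0 ∧
      (P.medium * w x + deriv (fun s => deriv w s - P.freq m * v s) x) *
        (Real.cos (P.freq m * y) : ℂ) = 0 := by
  have h1 : pdy (P.modeField m v w).curl x y = (deriv w x - P.freq m * v x) *
      -(P.freq m * (Real.sin (P.freq m * y) : ℂ)) := by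
    rw [curl_modeField]
    exact ((hasDerivAt_cos_freq (P.freq m) y).const_mul _).deriv
  have h2 : pdx (P.modeField m v w).curl x y = deriv (fun s => deriv w s - P.freq m * v s) x *
      (Real.cos (P.freq m * y) : ℂ) := by
    rw [curl_modeField]
    exact deriv_mul_const_field _
  rw [TEField.MaxwellAt, h1, h2]
  generalize deriv (fun s => deriv w s - P.freq m * v s) x = d
  simp only [modeField, medium]
  refine and_congr ?_ ?_ <;> rw [← neg_eq_zero] <;> ring_nf

lemma exists_sin_cos_freq_ne_zero (hP : P.Valid) (m : ℕ+) : ∃ y ∈ Set.Ioo 0 P.H,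
    (Real.sin (P.freq m * y) : ℂ) ≠ 0 ∧ (Real.cos (P.freq m * y) : ℂ) ≠ 0 := by
  have hH := hP.2.2.2.2
  have hm : (1 : ℝ) ≤ (m : ℕ) := by exact_mod_cast (one_le : 1 ≤ m)
  refine ⟨P.H / (4 * (m : ℕ)), ⟨by positivity, ?_⟩, ?_⟩
  · rw [div_lt_iff₀ (by positivity)]
    nlinarith [hm]
  · have : P.freq m * (P.H / (4 * (m : ℕ))) = Real.pi / 4 := by
      unfold freq; field_simp
    rw [this, Real.sin_pi_div_four, Real.cos_pi_div_four]
    have : (√2 / 2 : ℝ) ≠ 0 := by positivity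
    exact ⟨by exact_mod_cast this, by exact_mod_cast this⟩

/-- In one Fourier mode the damped Maxwell equation is a first order system. -/
lemma maxwell_system (hP : P.Valid) (hv : ContDiff ℝ 2 v) (hw : ContDiff ℝ 2 w) {a b : ℝ}
    (hab : a < b) (h : ∀ x ∈ Set.Ioo a b, ∀ y ∈ Set.Ioo 0 P.H,
      (P.modeField m v w).MaxwellAt P x y) :
    ∀ x ∈ Set.Icc a b, deriv v x = P.freq m * w x ∧
      P.freq m * deriv w x = P.decayRate m ^ 2 * v x := by
  obtain ⟨y, hy, hs, hc⟩ := exists_sin_cos_freq_ne_zero hP m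
  have hκ : (P.freq m : ℂ) ≠ 0 := by exact_mod_cast (freq_pos hP m).ne'
  have h1 : ∀ x ∈ Set.Ioo a b, P.freq m * deriv w x = P.decayRate m ^ 2 * v x := by
    intro x hx
    have := ((maxwellAt_modeField_iff x y).1 (h x hx y hy)).1
    have := (mul_eq_zero.1 this).resolve_right hs
    rw [decayRate_sq hP]
    linear_combination this
  have h2 : ∀ x ∈ Set.Ioo a b, deriv v x = P.freq m * w x := by
    intro x hx
    have := ((maxwellAt_modeField_iff x y).1 (h x hx y hy)).2
    have h3 := (mul_eq_zero.1 this).resolve_right hc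
    -- The first equation expresses the curl by `v`, so the second equation loses an order of
    -- differentiation.
    have h4 : (fun s => deriv w s - P.freq m * v s) =ᶠ[𝓝 x]
        fun s => -(P.medium / P.freq m) * v s := by
      filter_upwards [Ioo_mem_nhds hx.1 hx.2] with s hs
      have := h1 s hs
      rw [decayRate_sq hP] at this
      field_simp
      linear_combination this
    rw [h4.deriv_eq, deriv_const_mul_field] at h3
    have h5 : P.medium * (P.freq m * w x - deriv v x) = 0 := by
      field_simp at h3
      linear_combination h3
    have := (mul_eq_zero.1 h5).resolve_left (medium_ne_zero hP)
    linear_combination -this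
  have hdv : Continuous (deriv v) := hv.continuous_deriv (by norm_num)
  have hdw : Continuous (deriv w) := hw.continuous_deriv (by norm_num)
  have hvc := hv.continuous
  have hwc := hw.continuous
  intro x hx
  -- The traces are taken at the endpoints too, so the system is extended there by continuity.
  rw [← closure_Ioo hab.ne] at hx
  exact ⟨Set.EqOn.closure h2 hdv (by fun_prop) hx,
    Set.EqOn.closure h1 (by fun_prop) (by fun_prop) hx⟩

lemma eq_exp_mul_of_deriv_eq {f : ℝ → ℂ} {c : ℂ} {a b : ℝ} (hf : Differentiable ℝ f)
    (h : ∀ x ∈ Set.Icc a b, deriv f x = c * f x) {x y : ℝ} (hx : x ∈ Set.Icc a b)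
    (hy : y ∈ Set.Icc a b) : f x = Complex.exp (c * (x - y)) * f y := by
  have hderiv (s : ℝ) : HasDerivAt (fun s : ℝ => Complex.exp (-c * s) * f s)
      (Complex.exp (-c * s) * (deriv f s - c * f s)) s := by
    have h1 : HasDerivAt (fun s : ℝ => -c * (s : ℂ)) (-c) s := by
      simpa using (Complex.ofRealCLM.hasDerivAt (x := s)).const_mul (-c)
    exact (h1.cexp.mul (hf s).hasDerivAt).congr_deriv (by ring)
  have key : ∀ s ∈ Set.Icc a b,
      Complex.exp (-c * s) * f s = Complex.exp (-c * a) * f a := by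
    refine constant_of_has_deriv_right_zero (fun s _ => (hderiv s).continuousAt.continuousWithinAt)
      fun s hs => ?_
    have := (hderiv s).hasDerivWithinAt (s := Set.Ici s)
    rwa [h s (Set.Ico_subset_Icc_self hs), sub_self, mul_zero] at this
  have := (key x hx).trans (key y hy).symm
  calc f x = Complex.exp (c * x) * (Complex.exp (-c * x) * f x) := by
        rw [← mul_assoc, ← Complex.exp_add]; simp
    _ = Complex.exp (c * (x - y)) * f y := by
        rw [this, ← mul_assoc, ← Complex.exp_add]; congr 2; ring

end WaveGuide

/-! ### The iteration matrix -/

namespace WaveGuide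

/-- The quotient `i k λ / (k² - i k σ)` of the two terms of the impedance traces. -/
noncomputable def impedance (P : WaveGuide) (m : ℕ+) : ℂ :=
  Complex.I * P.k * P.decayRate m / P.medium

/-- The reflection coefficient of the impedance condition. -/
noncomputable def reflection (P : WaveGuide) (m : ℕ+) : ℂ :=
  (1 + P.impedance m) / (1 - P.impedance m)

/-- The decay of the mode across the overlap. -/
noncomputable def overlapDecay (P : WaveGuide) (m : ℕ+) : ℂ :=
  Complex.exp (-(P.decayRate m * (2 * P.δ)))

/-- The decay of the mode across the distance of consecutive subdomains. -/
noncomputable def shiftDecay (P : WaveGuide) (m : ℕ+) : ℂ :=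
  Complex.exp (-(P.decayRate m * P.L))

/-- The reflection coefficient damped by the overlap. -/
noncomputable def overlapReflection (P : WaveGuide) (m : ℕ+) : ℂ :=
  P.reflection m * P.overlapDecay m

/-- The coefficient with which a subdomain passes data on in the same direction. -/
noncomputable def passCoeff (P : WaveGuide) (m : ℕ+) : ℂ :=
  P.shiftDecay m * (1 - P.overlapReflection m ^ 2) /
    (1 - P.overlapReflection m ^ 2 * P.shiftDecay m ^ 2)

/-- The coefficient with which a subdomain reflects data. -/
noncomputable def reflectCoeff (P : WaveGuide) (m : ℕ+) : ℂ :=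
  -(P.overlapReflection m * (1 - P.shiftDecay m ^ 2)) /
    (1 - P.overlapReflection m ^ 2 * P.shiftDecay m ^ 2)

section coefficients

variable {P : WaveGuide} (hP : P.Valid) (m : ℕ+)
include hP

/-- After cancelling `k` and multiplying by the conjugate denominator, the real part has the sign of
`-(x * σ + y * k)`, where `x + i y` is the decay rate. -/
lemma impedance_re_neg : (P.impedance m).re < 0 := by
  have h1 := decayRate_re_pos hP m
  have h2 := decayRate_im_pos hP m
  obtain ⟨hk, hσ, -⟩ := hP
  have hm : P.medium = P.k * (P.k - Complex.I * P.σ) := by rw [medium]; ring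
  have hk' : (P.k : ℂ) ≠ 0 := by exact_mod_cast hk.ne'
  have : P.impedance m = Complex.I * P.decayRate m / (P.k - Complex.I * P.σ) := by
    rw [impedance, hm, mul_assoc, mul_left_comm, mul_div_mul_left _ _ hk']
  have hpos : 0 < Complex.normSq (P.k - Complex.I * P.σ) := by
    simp only [Complex.normSq_apply]
    simp
    positivity
  rw [this, Complex.div_re, ← add_div]
  refine div_neg_of_neg_of_pos ?_ hpos
  simp
  nlinarith [mul_pos h1 hσ, mul_pos h2 hk]

lemma one_sub_impedance_ne_zero : 1 - P.impedance m ≠ 0 := by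
  intro h
  have := congrArg Complex.re h
  have h2 := impedance_re_neg hP m
  simp at this
  linarith

lemma reflection_mul : P.reflection m * (1 - P.impedance m) = 1 + P.impedance m :=
  div_mul_cancel₀ _ (one_sub_impedance_ne_zero hP m)

lemma norm_reflection_lt_one : ‖P.reflection m‖ < 1 := by
  have h := impedance_re_neg hP m
  rw [reflection, norm_div, div_lt_one (norm_pos_iff.2 (one_sub_impedance_ne_zero hP m)),
    ← sq_lt_sq₀ (norm_nonneg _) (norm_nonneg _), ← Complex.normSq_eq_norm_sq,
    ← Complex.normSq_eq_norm_sq, Complex.normSq_apply, Complex.normSq_apply]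
  simp
  nlinarith

omit hP in
lemma norm_overlapDecay :
    ‖P.overlapDecay m‖ = Real.exp (-((P.decayRate m).re * (2 * P.δ))) := by
  rw [overlapDecay, Complex.norm_exp]
  simp

omit hP in
lemma norm_shiftDecay : ‖P.shiftDecay m‖ = Real.exp (-((P.decayRate m).re * P.L)) := by
  rw [shiftDecay, Complex.norm_exp]
  simp

lemma norm_shiftDecay_lt_one : ‖P.shiftDecay m‖ < 1 := by
  rw [norm_shiftDecay, Real.exp_lt_one_iff, neg_lt_zero]
  exact mul_pos (decayRate_re_pos hP m) hP.2.2.2.1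

lemma norm_overlapReflection_le :
    ‖P.overlapReflection m‖ ≤ Real.exp (-((P.decayRate m).re * (2 * P.δ))) := by
  rw [overlapReflection, norm_mul, norm_overlapDecay]
  exact mul_le_of_le_one_left (Real.exp_pos _).le (norm_reflection_lt_one hP m).le

lemma norm_overlapReflection_lt_one : ‖P.overlapReflection m‖ < 1 := by
  refine (norm_overlapReflection_le hP m).trans_lt ?_
  rw [Real.exp_lt_one_iff, neg_lt_zero]
  have := decayRate_re_pos hP m
  have := hP.2.2.1
  positivity

lemma norm_overlapReflection_mul_shiftDecay_lt_one :
    ‖P.overlapReflection m * P.shiftDecay m‖ < 1 := by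
  rw [norm_mul]
  exact mul_lt_one_of_nonneg_of_lt_one_left (norm_nonneg _) (norm_overlapReflection_lt_one hP m)
    (norm_shiftDecay_lt_one hP m).le

lemma one_sub_mul_ne_zero :
    1 - P.overlapReflection m * P.shiftDecay m ≠ 0 := fun h => by
  have := norm_overlapReflection_mul_shiftDecay_lt_one hP m
  rw [← sub_eq_zero.1 h] at this
  simp at this

lemma one_add_mul_ne_zero :
    1 + P.overlapReflection m * P.shiftDecay m ≠ 0 := fun h => by
  have := norm_overlapReflection_mul_shiftDecay_lt_one hP m
  rw [← neg_eq_of_add_eq_zero_right h] at this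
  simp at this

lemma one_sub_sq_ne_zero :
    1 - P.overlapReflection m ^ 2 * P.shiftDecay m ^ 2 ≠ 0 := by
  have : 1 - P.overlapReflection m ^ 2 * P.shiftDecay m ^ 2 =
      (1 - P.overlapReflection m * P.shiftDecay m) *
        (1 + P.overlapReflection m * P.shiftDecay m) := by ring
  rw [this]
  exact mul_ne_zero (one_sub_mul_ne_zero hP m) (one_add_mul_ne_zero hP m)

/-- For equal data on both sides the subdomain is symmetric, and one factor of `1 - g ^ 2 * u ^ 2`
cancels. -/
lemma passCoeff_add_reflectCoeff : P.passCoeff m + P.reflectCoeff m =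
    (P.shiftDecay m - P.overlapReflection m) / (1 - P.overlapReflection m * P.shiftDecay m) := by
  have h1 := one_sub_sq_ne_zero hP m
  have h2 := one_sub_mul_ne_zero hP m
  rw [passCoeff, reflectCoeff, ← add_div, div_eq_div_iff h1 h2]
  ring

lemma passCoeff_sub_reflectCoeff : P.passCoeff m - P.reflectCoeff m =
    (P.shiftDecay m + P.overlapReflection m) / (1 + P.overlapReflection m * P.shiftDecay m) := by
  have h1 := one_sub_sq_ne_zero hP m
  have h2 := one_add_mul_ne_zero hP m
  rw [passCoeff, reflectCoeff, ← sub_div, div_eq_div_iff h1 h2]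
  ring

lemma passCoeff_ne_zero : P.passCoeff m ≠ 0 := by
  refine div_ne_zero (mul_ne_zero (Complex.exp_ne_zero _) fun h => ?_) (one_sub_sq_ne_zero hP m)
  have h1 := norm_overlapReflection_lt_one hP m
  have h2 : ‖P.overlapReflection m‖ ^ 2 = 1 := by
    rw [← norm_pow, ← sub_eq_zero.1 h, norm_one]
  nlinarith [norm_nonneg (P.overlapReflection m)]

lemma impedance_mul_medium : P.impedance m * P.medium = Complex.I * P.k * P.decayRate m :=
  div_mul_cancel₀ _ (medium_ne_zero hP)

/-- A zero would force `medium ^ 2 = -k ^ 2 * (κ ^ 2 - medium)`, whose two sides have imaginary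
parts `-2 * k ^ 3 * σ` and `-k ^ 3 * σ`. It keeps `reflectCoeff` nonzero, as the spectral limit
requires. -/
lemma reflection_ne_zero : P.reflection m ≠ 0 := by
  refine div_ne_zero (fun h => ?_) (one_sub_impedance_ne_zero hP m)
  have h1 : P.medium = -(Complex.I * P.k * P.decayRate m) := by
    rw [← impedance_mul_medium hP m, eq_neg_of_add_eq_zero_right h]; ring
  have h2 : P.medium ^ 2 = -(P.k ^ 2 * (P.freq m ^ 2 - P.medium)) := by
    rw [h1, ← h1, ← decayRate_sq hP m, h1]
    linear_combination (P.k ^ 2 * P.decayRate m ^ 2 : ℂ) * Complex.I_sq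
  have h3 := congrArg Complex.im h2
  obtain ⟨hk, hσ, -⟩ := hP
  simp [medium, sq] at h3
  simp [hk.ne', hσ.ne'] at h3

lemma reflectCoeff_ne_zero : P.reflectCoeff m ≠ 0 := by
  refine div_ne_zero (neg_ne_zero.2 (mul_ne_zero (mul_ne_zero (reflection_ne_zero hP m)
    (Complex.exp_ne_zero _)) fun h => ?_)) (one_sub_sq_ne_zero hP m)
  have h1 := norm_shiftDecay_lt_one hP m
  have h2 : ‖P.shiftDecay m‖ ^ 2 = 1 := by
    rw [← norm_pow, ← sub_eq_zero.1 h, norm_one]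
  nlinarith [norm_nonneg (P.shiftDecay m)]

end coefficients

variable {P : WaveGuide} {m : ℕ+} {v w : ℝ → ℂ}

/-- The impedance traces in terms of the decaying and the growing part of a solution. -/
lemma trace_modeField_eq (hP : P.Valid) {x : ℝ}
    (hx : P.freq m * deriv w x = P.decayRate m ^ 2 * v x) :
    2 * P.freq m * P.decayRate m * (P.modeField m v w).traceL P x 0 = P.medium *
      ((1 + P.impedance m) * (P.decayRate m * v x + P.freq m * w x) +
        (1 - P.impedance m) * (P.decayRate m * v x - P.freq m * w x)) ∧
    2 * P.freq m * P.decayRate m * (P.modeField m v w).traceR P x 0 = -(P.medium *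
      ((1 - P.impedance m) * (P.decayRate m * v x + P.freq m * w x) +
        (1 + P.impedance m) * (P.decayRate m * v x - P.freq m * w x))) := by
  have h1 := impedance_mul_medium hP m
  have h2 := decayRate_sq hP m
  rw [traceL_modeField, traceR_modeField, mul_zero, Real.cos_zero, Complex.ofReal_one, mul_one,
    mul_one]
  constructor
  · linear_combination (-2 * P.decayRate m) * hx - 2 * P.freq m * w x * h1 -
      2 * P.decayRate m * v x * h2
  · linear_combination (2 * P.decayRate m) * hx - 2 * P.freq m * w x * h1 +
      2 * P.decayRate m * v x * h2

/-- The traces that a subdomain sends out, in terms of those that it receives. -/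
lemma scattering (hP : P.Valid) (hv : ContDiff ℝ 2 v) (hw : ContDiff ℝ 2 w) {s t : ℝ}
    (ht : t = s + (P.L + 2 * P.δ)) (h : ∀ x ∈ Set.Ioo s t, ∀ y ∈ Set.Ioo 0 P.H,
      (P.modeField m v w).MaxwellAt P x y) :
    (P.modeField m v w).traceR P (s + 2 * P.δ) 0 =
        P.passCoeff m * (P.modeField m v w).traceR P t 0 +
          P.reflectCoeff m * (P.modeField m v w).traceL P s 0 ∧
      (P.modeField m v w).traceL P (s + P.L) 0 =
        P.passCoeff m * (P.modeField m v w).traceL P s 0 +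
          P.reflectCoeff m * (P.modeField m v w).traceR P t 0 := by
  obtain ⟨-, -, hδ, hL, -⟩ := id hP
  have hst : s < t := by rw [ht]; linarith
  have hsys := maxwell_system hP hv hw hst h
  have hvd := hv.differentiable (by norm_num)
  have hwd := hw.differentiable (by norm_num)
  set lam := P.decayRate m with hlam
  set κ : ℂ := ((P.freq m : ℝ) : ℂ) with hκ
  have hκ0 : κ ≠ 0 := by rw [hκ]; exact_mod_cast (freq_pos hP m).ne'
  have hlam0 : lam ≠ 0 := decayRate_ne_zero hP m
  have hs : s ∈ Set.Icc s t := Set.left_mem_Icc.2 hst.le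
  have htm : t ∈ Set.Icc s t := Set.right_mem_Icc.2 hst.le
  have hsδ : s + 2 * P.δ ∈ Set.Icc s t := ⟨by linarith, by linarith⟩
  have hsL : s + P.L ∈ Set.Icc s t := ⟨by linarith, by linarith⟩
  -- The growing part is normalised at the right end and the decaying part at the left end, so that
  -- only decaying exponentials appear.
  have hp (x : ℝ) (hx : x ∈ Set.Icc s t) :
      lam * v x + κ * w x = Complex.exp (lam * (x - t)) * (lam * v t + κ * w t) := by
    refine eq_exp_mul_of_deriv_eq (f := fun x => lam * v x + κ * w x) (by fun_prop)
      (fun y hy => ?_) hx htm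
    obtain ⟨h1, h2⟩ := hsys y hy
    rw [deriv_fun_add ((hvd y).const_mul _) ((hwd y).const_mul _), deriv_const_mul_field,
      deriv_const_mul_field, h1, h2]
    ring
  have hq (x : ℝ) (hx : x ∈ Set.Icc s t) :
      lam * v x - κ * w x = Complex.exp (-lam * (x - s)) * (lam * v s - κ * w s) := by
    refine eq_exp_mul_of_deriv_eq (f := fun x => lam * v x - κ * w x) (by fun_prop)
      (fun y hy => ?_) hx hs
    obtain ⟨h1, h2⟩ := hsys y hy
    rw [deriv_fun_sub ((hvd y).const_mul _) ((hwd y).const_mul _), deriv_const_mul_field,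
      deriv_const_mul_field, h1, h2]
    ring
  obtain ⟨hLs, -⟩ := trace_modeField_eq hP (hsys s hs).2
  obtain ⟨-, hRt⟩ := trace_modeField_eq hP (hsys t htm).2
  obtain ⟨-, hRδ⟩ := trace_modeField_eq hP (hsys _ hsδ).2
  obtain ⟨hLL, -⟩ := trace_modeField_eq hP (hsys _ hsL).2
  simp only [← hκ, ← hlam] at hLs hRt hRδ hLL
  rw [hp s hs] at hLs
  rw [hq t htm] at hRt
  rw [hp _ hsδ, hq _ hsδ] at hRδ
  rw [hp _ hsL, hq _ hsL] at hLL
  have hD : Complex.exp (-lam * ((s + 2 * P.δ : ℝ) - s)) = P.overlapDecay m := by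
    rw [overlapDecay]; congr 1; push_cast; ring
  have hD' : Complex.exp (lam * ((s + P.L : ℝ) - t)) = P.overlapDecay m := by
    rw [overlapDecay, ht]; congr 1; push_cast; ring
  have hF : Complex.exp (-lam * ((s + P.L : ℝ) - s)) = P.shiftDecay m := by
    rw [shiftDecay]; congr 1; push_cast; ring
  have hF' : Complex.exp (lam * ((s + 2 * P.δ : ℝ) - t)) = P.shiftDecay m := by
    rw [shiftDecay, ht]; congr 1; push_cast; ring
  have hE : Complex.exp (-lam * (t - s)) = P.overlapDecay m * P.shiftDecay m := by
    rw [shiftDecay, overlapDecay, ← Complex.exp_add, ht]; congr 1; push_cast; ring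
  have hE' : Complex.exp (lam * (s - t)) = P.overlapDecay m * P.shiftDecay m := by
    rw [shiftDecay, overlapDecay, ← Complex.exp_add, ht]; congr 1; push_cast; ring
  rw [hE', ← reflection_mul hP m] at hLs
  rw [hE, ← reflection_mul hP m] at hRt
  rw [hD, hF', ← reflection_mul hP m] at hRδ
  rw [hD', hF, ← reflection_mul hP m] at hLL
  have hden := one_sub_sq_ne_zero hP m
  have h2 : 2 * κ * lam ≠ 0 := by simp [hκ0, hlam0]
  rw [passCoeff, reflectCoeff]
  simp only [overlapReflection] at hden ⊢
  constructor
  · refine mul_left_cancel₀ h2 ?_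
    rw [mul_add, mul_left_comm, mul_left_comm (2 * κ * lam) (_ / _), hRδ, hRt, hLs,
      div_mul_eq_mul_div, div_mul_eq_mul_div, ← add_div, eq_div_iff hden]
    ring
  · refine mul_left_cancel₀ h2 ?_
    rw [mul_add, mul_left_comm, mul_left_comm (2 * κ * lam) (_ / _), hLL, hRt, hLs,
      div_mul_eq_mul_div, div_mul_eq_mul_div, ← add_div, eq_div_iff hden]
    ring

end WaveGuide

/-! ### Solvability of the local problems and uniqueness of the iteration matrix -/

namespace WaveGuide

variable {P : WaveGuide} {m : ℕ+} {v w : ℝ → ℂ}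

lemma maxwellAt_modeField_of_system (hP : P.Valid) (h1 : ∀ x, deriv v x = P.freq m * w x)
    (h2 : ∀ x, P.freq m * deriv w x = P.decayRate m ^ 2 * v x) (x y : ℝ) :
    (P.modeField m v w).MaxwellAt P x y := by
  have hκ : (P.freq m : ℂ) ≠ 0 := by exact_mod_cast (freq_pos hP m).ne'
  have h3 : (fun s => deriv w s - P.freq m * v s) = fun s => -(P.medium / P.freq m) * v s := by
    ext s
    have := h2 s
    rw [decayRate_sq hP] at this
    field_simp
    linear_combination this
  rw [maxwellAt_modeField_iff, h3, deriv_const_mul_field, h1]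
  constructor
  · refine mul_eq_zero_of_left ?_ _
    have := h2 x
    rw [decayRate_sq hP] at this
    linear_combination this
  · refine mul_eq_zero_of_left ?_ _
    field_simp
    ring

/-- The impedance problem in a subdomain is solvable for all data. -/
lemma exists_mode_solution (hP : P.Valid) (m : ℕ+) {s t : ℝ} (ht : t = s + (P.L + 2 * P.δ))
    (gl gr : ℂ) : ∃ v w : ℝ → ℂ, ContDiff ℝ 2 v ∧ ContDiff ℝ 2 w ∧
      (∀ x y, (P.modeField m v w).MaxwellAt P x y) ∧
      (P.modeField m v w).traceL P s 0 = gl ∧ (P.modeField m v w).traceR P t 0 = gr := by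
  set lam := P.decayRate m with hlam
  set κ : ℂ := ((P.freq m : ℝ) : ℂ) with hκ
  have hκ0 : κ ≠ 0 := by rw [hκ]; exact_mod_cast (freq_pos hP m).ne'
  have hlam0 : lam ≠ 0 := decayRate_ne_zero hP m
  have hμ := medium_ne_zero hP
  have hz := one_sub_impedance_ne_zero hP m
  set E := P.overlapDecay m * P.shiftDecay m with hE
  have hE1 : Complex.exp (-lam * (t - s)) = E := by
    rw [hE, shiftDecay, overlapDecay, ← Complex.exp_add, ht]; congr 1; push_cast; ring
  have hE2 : Complex.exp (lam * (s - t)) = E := by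
    rw [← hE1]; congr 1; ring
  set r := P.reflection m with hr
  have hden : 1 - r ^ 2 * E ^ 2 ≠ 0 := by
    have := one_sub_sq_ne_zero hP m
    rw [overlapReflection] at this
    convert this using 2
    rw [hE]; ring
  set c : ℂ := P.medium * (1 - P.impedance m) with hc
  have hc0 : c ≠ 0 := mul_ne_zero hμ hz
  -- Cramer's rule for `c * (r * E * A + B) = 2 * κ * lam * gl` and `-c * (A + r * E * B) = 2 * κ *
  -- lam * gr`.
  set A : ℂ := 2 * κ * lam * (-gr - r * E * gl) / (c * (1 - r ^ 2 * E ^ 2)) with hA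
  set B : ℂ := 2 * κ * lam * (gl + r * E * gr) / (c * (1 - r ^ 2 * E ^ 2)) with hB
  set p : ℝ → ℂ := fun x => A * Complex.exp (lam * (x - t)) with hp
  set q : ℝ → ℂ := fun x => B * Complex.exp (-lam * (x - s)) with hq
  have hexp (d : ℂ) (u x : ℝ) : HasDerivAt (fun x : ℝ => Complex.exp (d * (x - u)))
      (d * Complex.exp (d * (x - u))) x := by
    have h1 : HasDerivAt (fun x : ℝ => d * ((x : ℂ) - u)) d x := by
      simpa using ((Complex.ofRealCLM.hasDerivAt (x := x)).sub_const (u : ℂ)).const_mul d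
    exact h1.cexp.congr_deriv (mul_comm _ _)
  have hpd (x : ℝ) : HasDerivAt p (lam * p x) x :=
    ((hexp lam t x).const_mul A).congr_deriv (by simp only [hp]; ring)
  have hqd (x : ℝ) : HasDerivAt q (-(lam * q x)) x :=
    ((hexp (-lam) s x).const_mul B).congr_deriv (by simp only [hq]; ring)
  have hcd (d : ℂ) (u : ℝ) : ContDiff ℝ 2 fun x : ℝ => Complex.exp (d * (x - u)) :=
    (contDiff_const.mul (Complex.ofRealCLM.contDiff.sub contDiff_const)).cexp
  have hpc : ContDiff ℝ 2 p := contDiff_const.mul (hcd lam t)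
  have hqc : ContDiff ℝ 2 q := contDiff_const.mul (hcd (-lam) s)
  set v : ℝ → ℂ := fun x => (p x + q x) / (2 * lam) with hv
  set w : ℝ → ℂ := fun x => (p x - q x) / (2 * κ) with hw
  have h1 (x : ℝ) : deriv v x = κ * w x := by
    have : deriv v x = _ := (((hpd x).add (hqd x)).div_const (2 * lam)).deriv
    rw [this]
    simp only [hw]
    field_simp
    ring
  have h2 (x : ℝ) : κ * deriv w x = lam ^ 2 * v x := by
    have : deriv w x = _ := (((hpd x).sub (hqd x)).div_const (2 * κ)).deriv
    rw [this]
    simp only [hv]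
    field_simp
    ring
  refine ⟨v, w, (hpc.add hqc).div_const _, (hpc.sub hqc).div_const _,
    maxwellAt_modeField_of_system hP h1 h2, ?_⟩
  have hpv (x : ℝ) : lam * v x + κ * w x = p x := by
    simp only [hv, hw]; field_simp; ring
  have hqv (x : ℝ) : lam * v x - κ * w x = q x := by
    simp only [hv, hw]; field_simp; ring
  obtain ⟨hL, -⟩ := trace_modeField_eq hP (h2 s)
  obtain ⟨-, hR⟩ := trace_modeField_eq hP (h2 t)
  simp only [← hlam, ← hκ, hpv, hqv, ← reflection_mul hP m, ← hr] at hL hR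
  have h3 : 2 * κ * lam ≠ 0 := by simp [hκ0, hlam0]
  have hps : p s = A * E := by simp only [hp]; rw [hE2]
  have hpt : p t = A := by simp [hp]
  have hqs : q s = B := by simp [hq]
  have hqt : q t = B * E := by simp only [hq]; rw [hE1]
  have hAc : A * c * (1 - r ^ 2 * E ^ 2) = 2 * κ * lam * (-gr - r * E * gl) := by
    rw [hA, mul_assoc, div_mul_cancel₀ _ (mul_ne_zero hc0 hden)]
  have hBc : B * c * (1 - r ^ 2 * E ^ 2) = 2 * κ * lam * (gl + r * E * gr) := by
    rw [hB, mul_assoc, div_mul_cancel₀ _ (mul_ne_zero hc0 hden)]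
  constructor
  · refine mul_left_cancel₀ (mul_ne_zero h3 hden) ?_
    rw [hps, hqs] at hL
    linear_combination (1 - r ^ 2 * E ^ 2) * hL + r * E * hAc + hBc
  · refine mul_left_cancel₀ (mul_ne_zero h3 hden) ?_
    rw [hpt, hqt] at hR
    linear_combination (1 - r ^ 2 * E ^ 2) * hR - hAc - r * E * hBc

/-- Traces of fields in one mode can be prescribed at any two points. -/
lemma exists_mode_traces (hP : P.Valid) (m : ℕ+) (s t : ℝ) (gl gr : ℂ) : ∃ v w : ℝ → ℂ,
    ContDiff ℝ 2 v ∧ ContDiff ℝ 2 w ∧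
      (P.modeField m v w).traceL P s 0 = gl ∧ (P.modeField m v w).traceR P t 0 = gr := by
  have hk : (P.k : ℂ) ≠ 0 := by exact_mod_cast hP.1.ne'
  have hd : 2 + Complex.I * P.k * (t - s) ≠ 0 := by
    intro h
    have := congrArg Complex.re h
    simp at this
  set c : ℂ := (gr - gl) / (2 + Complex.I * P.k * (t - s)) with hc
  set d : ℂ := (gl + c) / (Complex.I * P.k) - c * s with hd'
  have hc1 : c * (2 + Complex.I * P.k * (t - s)) = gr - gl := div_mul_cancel₀ _ hd
  have hd1 : Complex.I * P.k * (d + c * s) = gl + c := by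
    rw [hd', sub_add_cancel, mul_div_cancel₀ _ (mul_ne_zero Complex.I_ne_zero hk)]
  have hderiv (x : ℝ) : deriv (fun x : ℝ => d + c * (x : ℂ)) x = c := by
    have := ((Complex.ofRealCLM.hasDerivAt (x := x)).const_mul c).const_add d
    simpa using this.deriv
  -- Old errors need not solve the Maxwell equation, so an affine `w` with `v = 0` suffices. The
  -- denominator of `c` has real part `2`.
  refine ⟨fun _ => 0, fun x => d + c * x, contDiff_const,
    contDiff_const.add (contDiff_const.mul Complex.ofRealCLM.contDiff), ?_, ?_⟩
  · rw [traceL_modeField, hderiv]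
    simp
    linear_combination hd1
  · rw [traceR_modeField, hderiv]
    simp
    linear_combination hc1 + hd1

lemma freq_mul_height (hP : P.Valid) (m : ℕ+) : P.freq m * P.H = (m : ℕ) * Real.pi :=
  div_mul_cancel₀ _ hP.2.2.2.2.ne'

lemma isMode_modeField (hv : ContDiff ℝ 2 v) (hw : ContDiff ℝ 2 w) :
    (P.modeField m v w).IsMode P m := TEField.isMode_iff.2 ⟨v, w, hv, hw, rfl⟩

end WaveGuide

namespace TEField

variable {P : WaveGuide} {m : ℕ+} {E : TEField}

lemma IsMode.traceL_eq (hE : E.IsMode P m) (x y : ℝ) :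
    E.traceL P x y = E.traceL P x 0 * (Real.cos (P.freq m * y) : ℂ) := by
  obtain ⟨v, w, -, -, rfl⟩ := isMode_iff.1 hE
  simp [WaveGuide.traceL_modeField]

lemma IsMode.traceR_eq (hE : E.IsMode P m) (x y : ℝ) :
    E.traceR P x y = E.traceR P x 0 * (Real.cos (P.freq m * y) : ℂ) := by
  obtain ⟨v, w, -, -, rfl⟩ := isMode_iff.1 hE
  simp [WaveGuide.traceR_modeField]

end TEField

namespace WaveGuide

variable {P : WaveGuide} {m : ℕ+} {M : ℕ}

/-- The impedance data of the new errors are the interface data of the old ones. -/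
lemma ErrorStep.received (hP : P.Valid) {e e' : Fin (M + 1) → TEField}
    (h : P.ErrorStep m M e e') (j : Fin (M + 1)) :
    (e' j).traceL P (P.left j) 0 = leftData (P.interfaceData M e) j ∧
      (e' j).traceR P (P.right j) 0 = rightData (P.interfaceData M e) j := by
  -- Transmission is imposed only for `y` inside the guide, whereas amplitudes are values at `y =
  -- 0`; a height with nonzero cosine relates the two.
  obtain ⟨y, hy, -, hc⟩ := exists_sin_cos_freq_ne_zero hP m
  constructor
  · refine mul_right_cancel₀ hc ?_
    rw [← (h.mode_new j).traceL_eq]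
    cases j using Fin.cases with
    | zero => simpa using h.left_end y hy
    | succ i =>
      rw [h.transmit_left i y hy, (h.mode_old _).traceL_eq, leftData_succ]
      simp [interfaceData]
  · refine mul_right_cancel₀ hc ?_
    rw [← (h.mode_new j).traceR_eq]
    cases j using Fin.lastCases with
    | last => simpa using h.right_end y hy
    | cast i =>
      rw [h.transmit_right i y hy, (h.mode_old _).traceR_eq, rightData_castSucc]
      simp [interfaceData]

lemma isIterationMatrix_schwarzMatrix (hP : P.Valid) (m : ℕ+) (M : ℕ) :
    P.IsIterationMatrix m M (schwarzMatrix (P.passCoeff m) (P.reflectCoeff m) M) := by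
  intro e e' h
  have key (j : Fin (M + 1)) :
      (e' j).traceR P (P.left j + 2 * P.δ) 0 =
          P.passCoeff m * rightData (P.interfaceData M e) j +
            P.reflectCoeff m * leftData (P.interfaceData M e) j ∧
        (e' j).traceL P (P.left j + P.L) 0 =
          P.passCoeff m * leftData (P.interfaceData M e) j +
            P.reflectCoeff m * rightData (P.interfaceData M e) j := by
    rw [← (h.received hP j).1, ← (h.received hP j).2]
    have hmax := h.maxwell j
    obtain ⟨v, w, hv, hw, hE⟩ := TEField.isMode_iff.1 (h.mode_new j)
    rw [hE] at hmax ⊢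
    exact scattering hP hv hw rfl hmax
  ext ⟨i, s⟩
  rw [schwarzMatrix_mulVec]
  fin_cases s
  · have : P.right i = P.left (i + 1) + 2 * P.δ := by
      simp [right, left]; ring
    simpa [interfaceData, this] using (key i.succ).1
  · have : P.left (i + 1) = P.left i + P.L := by
      simp [left]; ring
    simpa [interfaceData, this] using (key i.castSucc).2

/-- All interface data occur. -/
lemma exists_errorStep (hP : P.Valid) (m : ℕ+) (M : ℕ) (g : Fin M × Fin 2 → ℂ) :
    ∃ e e' : Fin (M + 1) → TEField, P.ErrorStep m M e e' ∧ P.interfaceData M e = g := by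
  -- Traces sent rather than received: the last subdomain sends nothing to the right and the first
  -- nothing to the left, and the zeros are dummies.
  set gl : Fin (M + 1) → ℂ := Fin.snoc (α := fun _ => ℂ) (fun i => g (i, 1)) 0 with hgl
  set gr : Fin (M + 1) → ℂ := Fin.cons (α := fun _ => ℂ) 0 fun i => g (i, 0) with hgr
  choose v w hv hw hL hR using fun j : Fin (M + 1) =>
    exists_mode_traces hP m (P.left j + P.L) (P.left j + 2 * P.δ) (gl j) (gr j)
  choose v' w' hv' hw' hmax hL' hR' using fun j : Fin (M + 1) =>
    exists_mode_solution hP m (s := P.left j) (t := P.right j) rfl (leftData g j) (rightData g j)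
  have hright (i : Fin M) : P.right i.castSucc = P.left i.succ + 2 * P.δ := by
    simp [right, left]; ring
  have hleft (i : Fin M) : P.left i.succ = P.left i.castSucc + P.L := by
    simp [left]; ring
  have hold (j) : (P.modeField m (v j) (w j)).IsMode P m := isMode_modeField (hv j) (hw j)
  have hnew (j) : (P.modeField m (v' j) (w' j)).IsMode P m := isMode_modeField (hv' j) (hw' j)
  refine ⟨fun j => P.modeField m (v j) (w j), fun j => P.modeField m (v' j) (w' j),
    ⟨hold, hnew, fun j x _ y _ => hmax j x y, fun j x _ => ?_, fun i y _ => ?_, fun i y _ => ?_,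
      fun y _ => ?_, fun y _ => ?_⟩, ?_⟩
  · simp only [modeField]
    rw [freq_mul_height hP, Real.sin_nat_mul_pi]
    simp
  · rw [(hnew _).traceL_eq, (hold _).traceL_eq, hL', leftData_succ, hleft, hL]
    simp [hgl]
  · rw [(hnew _).traceR_eq, (hold _).traceR_eq, hR', rightData_castSucc, hright, hR]
    simp [hgr]
  · have := hL' 0
    rw [leftData_zero, Fin.val_zero] at this
    rw [(hnew _).traceL_eq, this, zero_mul]
  · have := hR' (Fin.last M)
    rw [rightData_last, Fin.val_last] at this
    rw [(hnew _).traceR_eq, this, zero_mul]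
  · ext ⟨i, s⟩
    fin_cases s
    · simp only [interfaceData, hright]
      simpa [hgr] using hR i.succ
    · simp only [interfaceData, hleft]
      simpa [hgl] using hL i.castSucc

lemma existsUnique_isIterationMatrix (hP : P.Valid) (m : ℕ+) (M : ℕ) :
    ∃! T : Matrix (Fin M × Fin 2) (Fin M × Fin 2) ℂ, P.IsIterationMatrix m M T := by
  refine ⟨_, isIterationMatrix_schwarzMatrix hP m M, fun T hT => ?_⟩
  refine Matrix.toLin'.injective (LinearMap.ext fun g => ?_)
  obtain ⟨e, e', h, rfl⟩ := exists_errorStep hP m M g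
  rw [Matrix.toLin'_apply, Matrix.toLin'_apply, ← hT e e' h,
    ← isIterationMatrix_schwarzMatrix hP m M e e' h]

lemma iterationMatrix_eq (hP : P.Valid) (m : ℕ+) (M : ℕ) :
    P.iterationMatrix m M = schwarzMatrix (P.passCoeff m) (P.reflectCoeff m) M :=
  (existsUnique_isIterationMatrix hP m M).unique
    (Classical.epsilon_spec (existsUnique_isIterationMatrix hP m M).exists)
    (isIterationMatrix_schwarzMatrix hP m M)

/-- The convergence factor of the `m`-th mode as a real number. -/
noncomputable def convFactor (P : WaveGuide) (m : ℕ+) : ℝ :=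
  max ‖P.passCoeff m + P.reflectCoeff m‖ ‖P.passCoeff m - P.reflectCoeff m‖

lemma rho_le (hP : P.Valid) (m : ℕ+) (M : ℕ) : P.rho m M ≤ ENNReal.ofReal (P.convFactor m) := by
  rw [rho, iterationMatrix_eq hP]
  exact spectralRadius_schwarzMatrix_le _ _ _

lemma tendsto_rho (hP : P.Valid) (m : ℕ+) :
    Filter.Tendsto (fun M : ℕ => P.rho m M) Filter.atTop (𝓝 (ENNReal.ofReal (P.convFactor m))) := by
  simp only [rho, iterationMatrix_eq hP]
  exact tendsto_spectralRadius_schwarzMatrix (passCoeff_ne_zero hP m) (reflectCoeff_ne_zero hP m)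

lemma R1d_eq (hP : P.Valid) (m : ℕ+) : P.R1d m = ENNReal.ofReal (P.convFactor m) :=
  (tendsto_rho hP m).limUnder_eq

/-- `rho_le` bounds all modes at once by their limits; from below, one mode close to the supremum
suffices. -/
lemma tendsto_iSup_rho (hP : P.Valid) :
    Filter.Tendsto (fun M : ℕ => ⨆ m : ℕ+, P.rho m M) Filter.atTop (𝓝 P.R2d) := by
  refine tendsto_order.2 ⟨fun r hr => ?_, fun r hr => Filter.Eventually.of_forall fun M =>
    (iSup_mono fun m => (rho_le hP m M).trans_eq (R1d_eq hP m).symm).trans_lt hr⟩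
  obtain ⟨m, hm⟩ := lt_iSup_iff.1 hr
  rw [R1d_eq hP] at hm
  filter_upwards [(tendsto_rho hP m).eventually_const_lt hm] with M hM
  exact hM.trans_le (le_iSup (fun m => P.rho m M) m)

end WaveGuide

/-! ### Estimates of the convergence factors -/

/-- `|1 ∓ g u|² - |u ∓ g|² = (1 - |u|²) (1 - |g|²) ± 4 Im u Im g`. -/
lemma Complex.norm_sub_lt_norm_one_sub_mul {u g : ℂ}
    (h : 4 * (|u.im| * |g.im|) < (1 - ‖u‖ ^ 2) * (1 - ‖g‖ ^ 2)) :
    ‖u - g‖ < ‖1 - g * u‖ ∧ ‖u + g‖ < ‖1 + g * u‖ := by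
  rw [← abs_mul] at h
  have h1 := le_abs_self (u.im * g.im)
  have h2 := neg_abs_le (u.im * g.im)
  rw [← Complex.normSq_eq_norm_sq, ← Complex.normSq_eq_norm_sq] at h
  simp only [Complex.normSq_apply] at h
  constructor <;>
  · rw [← sq_lt_sq₀ (norm_nonneg _) (norm_nonneg _), ← Complex.normSq_eq_norm_sq,
      ← Complex.normSq_eq_norm_sq]
    simp only [Complex.normSq_apply, Complex.sub_re, Complex.sub_im, Complex.add_re,
      Complex.add_im, Complex.mul_re, Complex.mul_im, Complex.one_re, Complex.one_im]
    linarith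

/-- After division by the modulus of the exponential this compares `|sin s| ≤ s` with `sinh s > s`.
-/
lemma Complex.im_exp_neg_bound {z : ℂ} (hre : 0 < z.re) (him : 0 < z.im) {t : ℝ} (ht : 0 < t) :
    2 * z.re * |(Complex.exp (-(z * t))).im| <
      z.im * (1 - ‖Complex.exp (-(z * t))‖ ^ 2) := by
  have h1 : (Complex.exp (-(z * t))).im = Real.exp (-(z.re * t)) * -Real.sin (z.im * t) := by
    rw [Complex.exp_im]; simp
  have h2 : ‖Complex.exp (-(z * t))‖ = Real.exp (-(z.re * t)) := by
    rw [Complex.norm_exp]; simp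
  rw [h1, h2, abs_mul, abs_neg, abs_of_pos (Real.exp_pos _)]
  have h3 : 1 - Real.exp (-(z.re * t)) ^ 2 =
      Real.exp (-(z.re * t)) * (2 * Real.sinh (z.re * t)) := by
    rw [Real.sinh_eq, mul_div_cancel₀ _ two_ne_zero, mul_sub, ← Real.exp_add, sq]
    simp
  have h4 : z.re * t < Real.sinh (z.re * t) := Real.self_lt_sinh_iff.2 (by positivity)
  have h5 : |Real.sin (z.im * t)| ≤ z.im * t :=
    Real.abs_sin_le_abs.trans_eq (abs_of_pos (by positivity))
  rw [h3]
  have hE := Real.exp_pos (-(z.re * t))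
  calc 2 * z.re * (Real.exp (-(z.re * t)) * |Real.sin (z.im * t)|)
      ≤ 2 * z.re * (Real.exp (-(z.re * t)) * (z.im * t)) := by gcongr
    _ = z.im * (Real.exp (-(z.re * t)) * (2 * (z.re * t))) := by ring
    _ < _ := by gcongr

/-- After division by the modulus of the exponential, both sides are compared with affine functions
of `t`; `h1` compares the constant terms and `h2` the slopes. -/
lemma Complex.im_mul_exp_neg_bound {z r : ℂ} (hre : 0 < z.re) (him : 0 < z.im) (hr : ‖r‖ ≤ 1)
    (h1 : 2 * z.im * |r.im| ≤ z.re * (1 - ‖r‖ ^ 2))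
    (h2 : 2 * z.im ^ 2 * |r.re| ≤ z.re ^ 2 * (1 + ‖r‖ ^ 2)) {t : ℝ} (ht : 0 < t) :
    2 * z.im * |(r * Complex.exp (-(z * t))).im| ≤
      z.re * (1 - ‖r * Complex.exp (-(z * t))‖ ^ 2) := by
  have e1 : (Complex.exp (-(z * t))).im = -(Real.exp (-(z.re * t)) * Real.sin (z.im * t)) := by
    rw [Complex.exp_im]; simp
  have e2 : (Complex.exp (-(z * t))).re = Real.exp (-(z.re * t)) * Real.cos (z.im * t) := by
    rw [Complex.exp_re]; simp
  have e3 : ‖Complex.exp (-(z * t))‖ = Real.exp (-(z.re * t)) := by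
    rw [Complex.norm_exp]; simp
  set E := Real.exp (-(z.re * t)) with hE
  have hE0 : 0 < E := Real.exp_pos _
  have h3 : 1 - (‖r‖ * E) ^ 2 =
      E * ((1 - ‖r‖ ^ 2) * Real.cosh (z.re * t) + (1 + ‖r‖ ^ 2) * Real.sinh (z.re * t)) := by
    have : E * Real.exp (z.re * t) = 1 := by rw [hE, ← Real.exp_add]; simp
    rw [Real.sinh_eq, Real.cosh_eq, ← hE]
    linear_combination -this
  have h4 : z.re * t ≤ Real.sinh (z.re * t) := Real.self_le_sinh_iff.2 (by positivity)
  have h5 : |Real.sin (z.im * t)| ≤ z.im * t :=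
    Real.abs_sin_le_abs.trans_eq (abs_of_pos (by positivity))
  have h6 : |(r * Complex.exp (-(z * t))).im| ≤ E * (|r.im| + |r.re| * (z.im * t)) := by
    have : (r * Complex.exp (-(z * t))).im =
        E * (r.im * Real.cos (z.im * t) - r.re * Real.sin (z.im * t)) := by
      rw [Complex.mul_im, e1, e2]; ring
    rw [this, abs_mul, abs_of_pos hE0]
    gcongr
    refine (abs_sub _ _).trans ?_
    rw [abs_mul, abs_mul]
    gcongr
    exact mul_le_of_le_one_right (abs_nonneg _) (Real.abs_cos_le_one _)
  have h7 : 0 ≤ 1 - ‖r‖ ^ 2 := by nlinarith [norm_nonneg r]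
  rw [norm_mul, e3, h3]
  calc 2 * z.im * |(r * Complex.exp (-(z * t))).im|
      ≤ 2 * z.im * (E * (|r.im| + |r.re| * (z.im * t))) := by gcongr
    _ = E * (2 * z.im * |r.im| + 2 * z.im ^ 2 * |r.re| * t) := by ring
    _ ≤ E * (z.re * (1 - ‖r‖ ^ 2) + z.re ^ 2 * (1 + ‖r‖ ^ 2) * t) := by gcongr
    _ = z.re * (E * ((1 - ‖r‖ ^ 2) * 1 + (1 + ‖r‖ ^ 2) * (z.re * t))) := by ring
    _ ≤ _ := by
      gcongr
      exact Real.one_le_cosh _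

namespace WaveGuide

variable {P : WaveGuide} {m : ℕ+}

lemma convFactor_lt_one (hP : P.Valid)
    (h1 : ‖P.shiftDecay m - P.overlapReflection m‖ <
      ‖1 - P.overlapReflection m * P.shiftDecay m‖)
    (h2 : ‖P.shiftDecay m + P.overlapReflection m‖ <
      ‖1 + P.overlapReflection m * P.shiftDecay m‖) : P.convFactor m < 1 := by
  rw [convFactor, passCoeff_add_reflectCoeff hP, passCoeff_sub_reflectCoeff hP, norm_div, norm_div,
    max_lt_iff, div_lt_one (norm_pos_iff.2 (one_sub_mul_ne_zero hP m)),
    div_lt_one (norm_pos_iff.2 (one_add_mul_ne_zero hP m))]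
  exact ⟨h1, h2⟩

lemma decayRate_re_sq_sub (hP : P.Valid) (m : ℕ+) :
    (P.decayRate m).re ^ 2 - (P.decayRate m).im ^ 2 = P.freq m ^ 2 - P.k ^ 2 := by
  have := congrArg Complex.re (decayRate_sq hP m)
  simp [sq, medium] at this
  linarith

lemma decayRate_re_mul_im (hP : P.Valid) (m : ℕ+) :
    2 * ((P.decayRate m).re * (P.decayRate m).im) = P.k * P.σ := by
  have := congrArg Complex.im (decayRate_sq hP m)
  simp [sq, medium] at this
  linarith

lemma impedance_re (hP : P.Valid) (m : ℕ+) : (P.impedance m).re * (P.k ^ 2 + P.σ ^ 2) =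
    -((P.decayRate m).re * P.σ + (P.decayRate m).im * P.k) ∧
    (P.impedance m).im * (P.k ^ 2 + P.σ ^ 2) =
      (P.decayRate m).re * P.k - (P.decayRate m).im * P.σ := by
  have hk : (P.k : ℂ) ≠ 0 := by exact_mod_cast hP.1.ne'
  have h : P.impedance m * ((P.k ^ 2 + P.σ ^ 2 : ℝ) : ℂ) =
      Complex.I * P.decayRate m * (P.k + Complex.I * P.σ) := by
    have h1 := impedance_mul_medium hP m
    rw [medium] at h1
    refine mul_left_cancel₀ hk ?_
    push_cast
    linear_combination (P.k + Complex.I * P.σ) * h1 +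
      (P.impedance m * P.k * P.σ ^ 2) * Complex.I_sq
  have hre := congrArg Complex.re h
  have him := congrArg Complex.im h
  rw [Complex.re_mul_ofReal] at hre
  rw [Complex.im_mul_ofReal] at him
  rw [hre, him]
  simp
  constructor <;> ring

lemma mul_abs_sub_le {x y k σ κ : ℝ} (hy : 0 < y) (hσ : 0 < σ)
    (e1 : x ^ 2 - y ^ 2 = κ ^ 2 - k ^ 2) (e2 : 2 * (x * y) = k * σ) :
    y * |x * k - y * σ| ≤ x * (x * σ + y * k) := by
  rw [← abs_of_pos hy, ← abs_mul, abs_of_pos hy, abs_le]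
  constructor
  · have : x * (x * σ + y * k) + y * (x * k - y * σ) = κ ^ 2 * σ := by
      linear_combination σ * e1 + k * e2
    have := mul_nonneg (sq_nonneg κ) hσ.le
    linarith
  · have := mul_nonneg (sq_nonneg x) hσ.le
    have := mul_pos (pow_pos hy 2) hσ
    linarith

/-- The only place where the size of `σ` enters: one of the two signs amounts to `0 ≤ κ ^ 2 * (σ ^ 2
- (k ^ 2 - κ ^ 2))`, the other holds always. -/
lemma sq_mul_abs_sub_le {x y k σ κ : ℝ} (hy : 0 < y)
    (hσ : k ^ 2 - κ ^ 2 ≤ σ ^ 2)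
    (e1 : x ^ 2 - y ^ 2 = κ ^ 2 - k ^ 2) (e2 : 2 * (x * y) = k * σ) :
    y ^ 2 * |k ^ 2 + σ ^ 2 - (x ^ 2 + y ^ 2)| ≤ x ^ 2 * (k ^ 2 + σ ^ 2 + (x ^ 2 + y ^ 2)) := by
  have hA : y ^ 2 - x ^ 2 = k ^ 2 - κ ^ 2 := by linarith
  rw [← abs_of_pos (pow_pos hy 2), ← abs_mul, abs_of_pos (pow_pos hy 2), abs_le]
  constructor
  · have h3 : 0 ≤ k ^ 2 + σ ^ 2 - (y ^ 2 - x ^ 2) := by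
      rw [hA]; linarith [sq_nonneg σ, sq_nonneg κ]
    have := mul_nonneg h3 (add_nonneg (sq_nonneg x) (sq_nonneg y))
    linarith
  · have h4 : (x ^ 2 + y ^ 2) ^ 2 = (k ^ 2 - κ ^ 2) ^ 2 + k ^ 2 * σ ^ 2 := by
      rw [← hA]; linear_combination (2 * (x * y) + k * σ) * e2
    have h3 : (y ^ 2 - x ^ 2) * (k ^ 2 + σ ^ 2) ≤ (x ^ 2 + y ^ 2) ^ 2 := by
      rw [h4, hA]
      linarith [mul_nonneg (sub_nonneg.2 hσ) (sq_nonneg κ)]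
    linarith

/-- Multiplication by `|1 - z|² (k² + σ²)`, with `z` the impedance, reduces the two bounds to
`mul_abs_sub_le` and `sq_mul_abs_sub_le`. -/
lemma reflection_bounds (hP : P.Valid) (hσ : P.k ^ 2 - P.freq m ^ 2 ≤ P.σ ^ 2) :
    2 * (P.decayRate m).im * |(P.reflection m).im| ≤
      (P.decayRate m).re * (1 - ‖P.reflection m‖ ^ 2) ∧
    2 * (P.decayRate m).im ^ 2 * |(P.reflection m).re| ≤
      (P.decayRate m).re ^ 2 * (1 + ‖P.reflection m‖ ^ 2) := by
  have hx := decayRate_re_pos hP m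
  have hy := decayRate_im_pos hP m
  have e1 := decayRate_re_sq_sub hP m
  have e2 := decayRate_re_mul_im hP m
  obtain ⟨e3, e4⟩ := impedance_re hP m
  have hr := reflection_mul hP m
  have hz : 0 < Complex.normSq (1 - P.impedance m) :=
    Complex.normSq_pos.2 (one_sub_impedance_ne_zero hP m)
  have hκ := freq_pos hP m
  obtain ⟨hk, hs, -⟩ := hP
  have h1 := congrArg Complex.normSq hr
  rw [Complex.normSq_mul] at h1
  rw [← Complex.normSq_eq_norm_sq]
  have hre := congrArg Complex.re hr
  have him := congrArg Complex.im hr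
  set r := P.reflection m
  set z := P.impedance m
  set x := (P.decayRate m).re
  set y := (P.decayRate m).im
  set N := Complex.normSq (1 - z) with hN
  have hN' : N = (1 - z.re) ^ 2 + z.im ^ 2 := by
    rw [hN, Complex.normSq_apply]; simp; ring
  have hN1 : Complex.normSq (1 + z) = (1 + z.re) ^ 2 + z.im ^ 2 := by
    rw [Complex.normSq_apply]; simp; ring
  simp at hre him
  have him' : r.im * N = 2 * z.im := by
    rw [hN']; linear_combination (1 - z.re) * him + z.im * hre
  have hre' : r.re * N = 1 - (z.re ^ 2 + z.im ^ 2) := by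
    rw [hN']; linear_combination (1 - z.re) * hre - z.im * him
  have hS : 0 < P.k ^ 2 + P.σ ^ 2 := by positivity
  set S := P.k ^ 2 + P.σ ^ 2 with hSdef
  have hnz : (z.re ^ 2 + z.im ^ 2) * S = x ^ 2 + y ^ 2 := by
    refine mul_right_cancel₀ hS.ne' ?_
    have : (z.re ^ 2 + z.im ^ 2) * S * S = (z.re * S) ^ 2 + (z.im * S) ^ 2 := by ring
    rw [this, e3, e4, hSdef]; ring
  constructor
  · refine le_of_mul_le_mul_right ?_ (mul_pos hz hS)
    have hL : 2 * y * |r.im| * (N * S) = 4 * (y * |x * P.k - y * P.σ|) := by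
      have : |r.im| * (N * S) = 2 * |x * P.k - y * P.σ| := by
        rw [← e4, ← abs_of_pos hz, ← abs_of_pos hS, ← abs_mul, ← abs_mul, ← mul_assoc, him',
          abs_of_pos hS, mul_assoc, abs_mul, abs_two]
      linear_combination 2 * y * this
    have hR : x * (1 - Complex.normSq r) * (N * S) = 4 * (x * (x * P.σ + y * P.k)) := by
      have : (1 - Complex.normSq r) * N = -4 * z.re := by
        rw [sub_mul, h1, hN1, hN']; ring
      linear_combination x * S * this - 4 * x * e3
    rw [hL, hR]
    have hle := mul_abs_sub_le hy hs e1 e2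
    linarith
  · refine le_of_mul_le_mul_right ?_ (mul_pos hz hS)
    have hL : 2 * y ^ 2 * |r.re| * (N * S) = 2 * (y ^ 2 * |S - (x ^ 2 + y ^ 2)|) := by
      have : |r.re| * (N * S) = |S - (x ^ 2 + y ^ 2)| := by
        rw [← hnz, ← abs_of_pos hz, ← abs_of_pos hS, ← abs_mul, ← abs_mul, ← mul_assoc, hre',
          abs_of_pos hS]
        ring_nf
      linear_combination 2 * y ^ 2 * this
    have hR : x ^ 2 * (1 + Complex.normSq r) * (N * S) =
        2 * (x ^ 2 * (S + (x ^ 2 + y ^ 2))) := by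
      have : (1 + Complex.normSq r) * N = 2 * (1 + (z.re ^ 2 + z.im ^ 2)) := by
        rw [add_mul, h1, hN1, hN']; ring
      linear_combination x ^ 2 * S * this + 2 * x ^ 2 * hnz
    rw [hL, hR]
    have hle := sq_mul_abs_sub_le hy hσ e1 e2
    linarith

/-- All modes converge that are not strongly propagating in comparison with the damping. -/
lemma convFactor_lt_one_of_sq_sub_le (hP : P.Valid) (hσ : P.k ^ 2 - P.freq m ^ 2 ≤ P.σ ^ 2) :
    P.convFactor m < 1 := by
  have hx := decayRate_re_pos hP m
  have hy := decayRate_im_pos hP m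
  obtain ⟨h1, h2⟩ := reflection_bounds hP hσ
  have hu : 2 * (P.decayRate m).re * |(P.shiftDecay m).im| <
      (P.decayRate m).im * (1 - ‖P.shiftDecay m‖ ^ 2) :=
    Complex.im_exp_neg_bound hx hy hP.2.2.2.1
  have hg : 2 * (P.decayRate m).im * |(P.overlapReflection m).im| ≤
      (P.decayRate m).re * (1 - ‖P.overlapReflection m‖ ^ 2) := by
    have := Complex.im_mul_exp_neg_bound hx hy (norm_reflection_lt_one hP m).le h1 h2
      (t := 2 * P.δ) (by have := hP.2.2.1; positivity)
    rw [overlapReflection, overlapDecay]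
    simpa using this
  have hG : 0 < 1 - ‖P.overlapReflection m‖ ^ 2 := by
    have := norm_overlapReflection_lt_one hP m
    nlinarith [norm_nonneg (P.overlapReflection m)]
  have key : 4 * (|(P.shiftDecay m).im| * |(P.overlapReflection m).im|) <
      (1 - ‖P.shiftDecay m‖ ^ 2) * (1 - ‖P.overlapReflection m‖ ^ 2) := by
    -- The weights `x / y` and `y / x` of the two bounds cancel in the product.
    set x := (P.decayRate m).re
    set y := (P.decayRate m).im
    refine lt_of_mul_lt_mul_left ?_ (mul_pos hx hy).le
    calc x * y * (4 * (|(P.shiftDecay m).im| * |(P.overlapReflection m).im|))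
        = 2 * x * |(P.shiftDecay m).im| * (2 * y * |(P.overlapReflection m).im|) := by ring
      _ ≤ 2 * x * |(P.shiftDecay m).im| * (x * (1 - ‖P.overlapReflection m‖ ^ 2)) := by gcongr
      _ < y * (1 - ‖P.shiftDecay m‖ ^ 2) * (x * (1 - ‖P.overlapReflection m‖ ^ 2)) := by
        gcongr
      _ = _ := by ring
  obtain ⟨h3, h4⟩ := Complex.norm_sub_lt_norm_one_sub_mul key
  exact convFactor_lt_one hP h3 h4

lemma convFactor_lt_one_of_norm (hP : P.Valid)
    (h : ‖P.shiftDecay m‖ + ‖P.overlapReflection m‖ +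
      ‖P.shiftDecay m‖ * ‖P.overlapReflection m‖ < 1) : P.convFactor m < 1 := by
  set u := P.shiftDecay m
  set g := P.overlapReflection m
  have h1 : 1 - ‖u‖ * ‖g‖ ≤ ‖1 - g * u‖ := by
    have := norm_sub_norm_le 1 (g * u)
    rw [norm_one, norm_mul] at this
    linarith
  have h2 : 1 - ‖u‖ * ‖g‖ ≤ ‖1 + g * u‖ := by
    have := norm_sub_norm_le 1 (-(g * u))
    rw [norm_one, norm_neg, norm_mul, sub_neg_eq_add] at this
    linarith
  exact convFactor_lt_one hP (by linarith [norm_sub_le u g]) (by linarith [norm_add_le u g])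

lemma convFactor_le_half (hP : P.Valid) (hu : ‖P.shiftDecay m‖ ≤ 1 / 8)
    (hg : ‖P.overlapReflection m‖ ≤ 1 / 8) : P.convFactor m ≤ 1 / 2 := by
  rw [convFactor, passCoeff_add_reflectCoeff hP, passCoeff_sub_reflectCoeff hP, norm_div, norm_div,
    max_le_iff, div_le_iff₀ (norm_pos_iff.2 (one_sub_mul_ne_zero hP m)),
    div_le_iff₀ (norm_pos_iff.2 (one_add_mul_ne_zero hP m))]
  set u := P.shiftDecay m
  set g := P.overlapReflection m
  have h0 : ‖u‖ * ‖g‖ ≤ 1 / 8 * (1 / 8) := by gcongr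
  have h1 : 1 - ‖u‖ * ‖g‖ ≤ ‖1 - g * u‖ := by
    have := norm_sub_norm_le 1 (g * u)
    rw [norm_one, norm_mul] at this
    linarith
  have h2 : 1 - ‖u‖ * ‖g‖ ≤ ‖1 + g * u‖ := by
    have := norm_sub_norm_le 1 (-(g * u))
    rw [norm_one, norm_neg, norm_mul, sub_neg_eq_add] at this
    linarith
  constructor
  · linarith [norm_sub_le u g]
  · linarith [norm_add_le u g]

lemma freq_sub_le_decayRate_re (hP : P.Valid) (m : ℕ+) :
    P.freq m - P.k ≤ (P.decayRate m).re := by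
  have hx := decayRate_re_pos hP m
  have e1 := decayRate_re_sq_sub hP m
  have hk := hP.1
  by_contra! h
  nlinarith [sq_nonneg (P.decayRate m).im]

lemma exists_forall_convFactor_le_half (hP : P.Valid) :
    ∃ m₀ : ℕ+, ∀ m, m₀ ≤ m → P.convFactor m ≤ 1 / 2 := by
  obtain ⟨hk, -, hδ, hL, hH⟩ := id hP
  -- A decay rate of at least `X` puts both exponents beyond `7`, and `exp 7 ≥ 1 + 7 = 8`.
  set X := 7 / P.L + 7 / (2 * P.δ) with hX
  obtain ⟨n, hn⟩ := exists_nat_ge ((X + P.k) * P.H / Real.pi)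
  refine ⟨n.succPNat, fun m hm => ?_⟩
  have hnm : (n : ℝ) ≤ (m : ℕ) := by
    have : n + 1 ≤ (m : ℕ) := by exact_mod_cast hm
    exact_mod_cast (Nat.le_succ n).trans this
  have hf : X + P.k ≤ P.freq m := by
    rw [div_le_iff₀ Real.pi_pos] at hn
    rw [freq, le_div_iff₀ hH]
    exact hn.trans (by gcongr)
  have hx : X ≤ (P.decayRate m).re := by linarith [freq_sub_le_decayRate_re hP m]
  have hexp : ∀ s : ℝ, 7 ≤ s → Real.exp (-s) ≤ 1 / 8 := by
    intro s hs
    rw [Real.exp_neg, one_div]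
    exact inv_anti₀ (by norm_num) (by linarith [Real.add_one_le_exp s])
  refine convFactor_le_half hP ?_ ((norm_overlapReflection_le hP m).trans ?_)
  · rw [norm_shiftDecay]
    apply hexp
    rw [← div_le_iff₀ hL]
    exact (le_add_of_nonneg_right (by positivity)).trans hx
  · apply hexp
    rw [← div_le_iff₀ (by positivity)]
    exact (le_add_of_nonneg_left (by positivity)).trans hx

lemma R1d_lt_one (hP : P.Valid) (h : P.convFactor m < 1) : P.R1d m < 1 := by
  rw [R1d_eq hP]
  exact ENNReal.ofReal_lt_one.2 h

/-- All but finitely many factors are at most `1 / 2`, so strictness survives the supremum. -/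
lemma R2d_lt_one (hP : P.Valid) (h : ∀ m, P.convFactor m < 1) : P.R2d < 1 := by
  obtain ⟨m₀, hm₀⟩ := exists_forall_convFactor_le_half hP
  have hle : P.R2d ≤ max ((Finset.Iio m₀).sup P.R1d) (ENNReal.ofReal (1 / 2)) := by
    refine iSup_le fun m => ?_
    rcases lt_or_ge m m₀ with hm | hm
    · exact (Finset.le_sup (f := P.R1d) (Finset.mem_Iio.2 hm)).trans (le_max_left _ _)
    · rw [R1d_eq hP]
      exact (ENNReal.ofReal_le_ofReal (hm₀ m hm)).trans (le_max_right _ _)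
  refine hle.trans_lt (max_lt ((Finset.sup_lt_iff (by simp)).2 fun m _ => R1d_lt_one hP (h m)) ?_)
  exact ENNReal.ofReal_lt_one.2 (by norm_num)

lemma R2d_lt_one_of_le (hP : P.Valid) (h : P.k ≤ P.σ) : P.R2d < 1 := by
  refine R2d_lt_one hP fun m => convFactor_lt_one_of_sq_sub_le hP ?_
  have := hP.1
  nlinarith [sq_nonneg (P.freq m)]

/-- Since `2 * x * y = k * σ`, a smaller `x` would force `y > 2 * k`, and then `x ^ 2 = y ^ 2 + κ ^
2 - k ^ 2` would exceed `k ^ 2`. The bound involves neither the mode nor the height. -/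
lemma div_four_le_decayRate_re (hP : P.Valid) {ε : ℝ} (hε : ε ≤ P.σ) (hσ : P.σ ≤ P.k) (m : ℕ+) :
    ε / 4 ≤ (P.decayRate m).re := by
  have hx := decayRate_re_pos hP m
  have hy := decayRate_im_pos hP m
  have e1 := decayRate_re_sq_sub hP m
  have e2 := decayRate_re_mul_im hP m
  obtain ⟨hk, hs, -⟩ := hP
  set x := (P.decayRate m).re
  set y := (P.decayRate m).im
  by_contra! h
  have hyk : 2 * P.k < y := by
    by_contra! hyk
    nlinarith [mul_le_mul_of_nonneg_left hyk hx.le, mul_pos hk hs]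
  have hxk : x < P.k := by linarith
  nlinarith [sq_nonneg (P.freq m)]

lemma exists_forall_R2d_lt_one {k ε : ℝ} (hε : 0 < ε) :
    ∃ C : ℝ, ∀ P : WaveGuide, P.Valid → P.k = k →
      ε ≤ P.σ → ε ≤ P.δ → ε ≤ P.L → (C ≤ P.σ ∨ C ≤ P.δ ∨ C ≤ P.L) → P.R2d < 1 := by
  set q := Real.exp (-(ε / 4 * ε)) with hq
  have hq1 : q < 1 := by rw [hq, Real.exp_lt_one_iff, neg_lt_zero]; positivity
  -- Both moduli are at most `q`; `C₀` makes one of them at most `(1 - q) / 3`, so that `q + (1 - q)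
  -- / 3 + q * (1 - q) / 3 < 1`.
  set C₀ := -(4 / ε) * Real.log ((1 - q) / 3) with hC₀
  have hC : Real.exp (-(ε / 4 * C₀)) = (1 - q) / 3 := by
    rw [← Real.exp_log (show 0 < (1 - q) / 3 by linarith)]
    congr 1
    rw [hC₀]
    field_simp
  -- The `k` in the maximum sends a large `σ` to the case `k ≤ σ`; otherwise `δ` or `L` is the large
  -- parameter.
  refine ⟨max k C₀, fun P hP hk hσ hδ hL hC' => ?_⟩
  rcases le_or_gt P.k P.σ with hkσ | hkσ
  · exact R2d_lt_one_of_le hP hkσ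
  refine R2d_lt_one hP fun m => convFactor_lt_one_of_norm hP ?_
  have hx := div_four_le_decayRate_re hP hσ hkσ.le m
  have hδ0 := hP.2.2.1
  have hL0 := hP.2.2.2.1
  have hu (t : ℝ) (ht : t ≤ P.L) : ‖P.shiftDecay m‖ ≤ Real.exp (-(ε / 4 * t)) := by
    rw [norm_shiftDecay]
    refine Real.exp_le_exp.2 (neg_le_neg ?_)
    exact (mul_le_mul_of_nonneg_left ht (by positivity)).trans (by gcongr)
  have hg (t : ℝ) (ht : t ≤ P.δ) : ‖P.overlapReflection m‖ ≤ Real.exp (-(ε / 4 * t)) := by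
    refine (norm_overlapReflection_le hP m).trans ?_
    refine Real.exp_le_exp.2 (neg_le_neg ?_)
    exact (mul_le_mul_of_nonneg_left (show t ≤ 2 * P.δ by linarith) (by positivity)).trans
      (by gcongr)
  have hu1 := hu ε hL
  have hg1 := hg ε hδ
  have hu0 := norm_nonneg (P.shiftDecay m)
  have hg0 := norm_nonneg (P.overlapReflection m)
  have hcase : ‖P.shiftDecay m‖ ≤ (1 - q) / 3 ∨ ‖P.overlapReflection m‖ ≤ (1 - q) / 3 := by
    rcases hC' with h | h | h
    · exact absurd ((le_max_left _ _).trans h) (by rw [← hk]; exact hkσ.not_ge)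
    · exact Or.inr ((hg C₀ ((le_max_right _ _).trans h)).trans_eq hC)
    · exact Or.inl ((hu C₀ ((le_max_right _ _).trans h)).trans_eq hC)
  rcases hcase with h | h <;> nlinarith

end WaveGuide

theorem theorem4p4 :
    (∀ P : WaveGuide, P.Valid →
      -- the iteration matrices are well defined
      (∀ (m : ℕ+) (M : ℕ), ∃! T : Matrix (Fin M × Fin 2) (Fin M × Fin 2) ℂ,
        P.IsIterationMatrix m M T) ∧
      -- the limits that define the convergence factors of the modes exist
      (∀ m : ℕ+, Filter.Tendsto (fun M : ℕ => P.rho m M) Filter.atTop (𝓝 (P.R1d m))) ∧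
      -- evanescent modes converge
      (∀ m : ℕ+, P.k < P.freq m → P.R1d m < 1) ∧
      -- all modes converge, uniformly, under large damping
      (P.k ≤ P.σ → P.R2d < 1) ∧
      -- the convergence is ultimately independent of the number of subdomains
      Filter.Tendsto (fun M : ℕ => ⨆ m : ℕ+, P.rho m M) Filter.atTop (𝓝 P.R2d)) ∧
    -- all modes converge, uniformly, if `σ`, `δ`, `L` are between them sufficiently large
    (∀ k ε : ℝ, 0 < k → 0 < ε → ∃ C : ℝ, ∀ P : WaveGuide, P.Valid → P.k = k →
      ε ≤ P.σ → ε ≤ P.δ → ε ≤ P.L → (C ≤ P.σ ∨ C ≤ P.δ ∨ C ≤ P.L) → P.R2d < 1) := by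
  refine ⟨fun P hP => ⟨WaveGuide.existsUnique_isIterationMatrix hP, fun m => ?_, fun m hm => ?_,
    WaveGuide.R2d_lt_one_of_le hP, WaveGuide.tendsto_iSup_rho hP⟩,
    fun k ε _ hε => WaveGuide.exists_forall_R2d_lt_one hε⟩
  · rw [WaveGuide.R1d_eq hP]
    exact WaveGuide.tendsto_rho hP m
  · refine WaveGuide.R1d_lt_one hP (WaveGuide.convFactor_lt_one_of_sq_sub_le hP ?_)
    have := hP.1
    nlinarith [sq_nonneg P.σ]
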